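/- All graphs are finite and simple. For an integer $d\ge 1$, a $d$-box is a cartesian product $I_1\times\cdots\times I_d$ of $d$ nonempty closed bounded intervals of $\mathbb{R}$, and the boxicity of a graph $G$ is the least $d\ge 1$ for which one can assign to every vertex $v$ of $G$ a $d$-box $B_v$ so that, for any two distinct vertices $u$ and $v$, the boxes $B_u$ and $B_v$ intersect if and only if $u$ and $v$ are adjacent. The girth of $G$ is the length of a shortest cycle of $G$, and is $\infty$ if $G$ has no cycle. A class of graphs is minor-closed if it contains every graph isomorphic to a minor of one of its members, and proper if it does not contain all graphs. For every proper minor-closed class $\mathcal{F}$ of graphs there is an integer $g=g(\mathcal{F})$ such that every graph in $\mathcal{F}$ of girth at least $g$ has boxicity at most $3$. Moreover, the bound $3$ is best possible, already for $K_6$-minor-free graphs: for every integer $g$ there is a graph with no $K_6$-minor, of girth at least $g$, whose boxicity is exactly $3$. -/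

import Mathlib

universe u

namespace BoxGraph

/-- A `d`-box: the cartesian product of `d` (nonempty, closed, bounded) intervals of `ℝ`. -/
def IsBox {d : ℕ} (B : Set (Fin d → ℝ)) : Prop :=
  ∃ a b : Fin d → ℝ, (∀ i, a i ≤ b i) ∧ B = Set.univ.pi fun i => Set.Icc (a i) (b i)

/-- `B` is a `d`-box representation of `G`: a family of `d`-boxes indexed by the vertices such that
the boxes of two distinct vertices intersect if and only if these vertices are adjacent. -/
def IsBoxRepresentation {V : Type*} (G : SimpleGraph V) {d : ℕ} (B : V → Set (Fin d → ℝ)) : Prop :=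
  (∀ v, IsBox (B v)) ∧ ∀ u v, u ≠ v → ((B u ∩ B v).Nonempty ↔ G.Adj u v)

/-- The boxicity of `G`: the least `d ≥ 1` such that `G` has a `d`-box representation
(`⊤` if there is none, which does not happen for finite graphs). -/
noncomputable def boxicity {V : Type*} (G : SimpleGraph V) : ℕ∞ :=
  ⨅ (d : ℕ) (_ : 1 ≤ d ∧ ∃ B : V → Set (Fin d → ℝ), IsBoxRepresentation G B), (d : ℕ∞)

/-- `H` is a minor of `G`: there are pairwise disjoint nonempty connected sets of vertices of `G`,
one for each vertex of `H` (the branch sets), such that the sets of any two adjacent vertices of `H`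
are joined by an edge of `G`. (`SimpleGraph.Connected` includes nonemptiness.) -/
def IsMinor {W V : Type*} (H : SimpleGraph W) (G : SimpleGraph V) : Prop :=
  ∃ B : W → Set V, (∀ w, (G.induce (B w)).Connected) ∧
    (∀ w w', w ≠ w' → Disjoint (B w) (B w')) ∧
    ∀ w w', H.Adj w w' → ∃ x ∈ B w, ∃ y ∈ B w', G.Adj x y

/-- A class of finite simple graphs. -/
abbrev GraphClass : Type (u + 1) := ∀ (V : Type u) [Finite V], SimpleGraph V → Prop

/-- Every (isomorphic copy of a) minor of a graph in `F` is in `F`. -/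
def GraphClass.IsMinorClosed (F : GraphClass.{u}) : Prop :=
  ∀ (V W : Type u) [Finite V] [Finite W] (G : SimpleGraph V) (H : SimpleGraph W),
    F V G → IsMinor H G → F W H

/-- Some finite graph is not in `F`. -/
def GraphClass.IsProper (F : GraphClass.{u}) : Prop :=
  ∃ (V : Type u) (_ : Finite V) (G : SimpleGraph V), ¬ F V G

end BoxGraph

/-!
**The upper bound.** A proper minor-closed class excludes some complete graph `K_t` as a minor. A
graph is *reducible* if it has a vertex of degree at most one, or a path with four inner vertices,
all of degree two. A nonempty graph of large girth without a `K_t` minor is reducible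
(`isReducible_of_not_isMinor`). Indeed, if neither configuration occurs, every nonbacktracking walk
soon meets a vertex of degree at least three, so a ball whose radius is large, but small against
the girth, contains many such vertices. Contracting the cells of a Voronoi partition around a
maximal set of separated centers gives a graph with many edges per vertex: the cells are trees,
and by the girth no two edges become parallel. A graph with many edges per vertex contains `K_t`,
in a form in which all branch sets have at least two vertices, by induction on `t`: the piece
between two layers of some breadth-first search is again dense, and the union of the layers below
supplies one more branch set (`hasFatModel_of_dense`).

A graph all of whose nonempty induced subgraphs are reducible has boxicity at most three
(`exists_isPointedRep`). The representation is built by adding removed vertices back, with a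
stronger inductive hypothesis: over some point of the footprint of every box, the vertical ray from
the top of the box meets no other box. A leaf becomes a thin column next to the ray of its neighbor
(`exists_leaf`). For a removed path, the first and last inner vertices become columns on the boxes
of the two ends, higher than everything else, and the two middle ones become a bridge of two
slabs between these columns (`exists_bridge`).

**Sharpness.** Take `K_{3,3}` with every edge subdivided many times. Its girth is large. A branch
set of a `K_6` model is connected and sends out five edges, so in a graph of maximum degree three it
contains at least three vertices of degree three; that makes eighteen, but there are only six
(`not_isMinor_K6`). Hence the first part bounds the boxicity by three. A representation by boxes in
the plane, made integral, would give connected subsets of the grid `ℤ × ℤ` that realize a drawing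
of `K_{3,3}`. A parity argument excludes this (`grid_K33_sets`): shift one of two walks by
`(1/2, 1/2)` and count their crossings modulo two. Two closed walks cross an even number of times,
whereas three walks leaving a common point in different directions cross each other exactly once
there, in the sum over all ordered pairs (`cross_three`).
-/

namespace BoxGraph

/-! ### Connected vertex sets and minors -/

/-- Connectedness of a vertex set, through walks of the ambient graph that stay in the set. -/
lemma connected_induce_iff {V : Type*} {G : SimpleGraph V} {s : Set V} :
    (G.induce s).Connected ↔
      s.Nonempty ∧ ∀ x ∈ s, ∀ y ∈ s, ∃ p : G.Walk x y, ∀ z ∈ p.support, z ∈ s := by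
  constructor
  · intro h
    refine ⟨Set.nonempty_coe_sort.1 h.nonempty, fun x hx y hy => ?_⟩
    obtain ⟨p⟩ := h.preconnected ⟨x, hx⟩ ⟨y, hy⟩
    refine ⟨p.map (SimpleGraph.Embedding.induce s).toHom, fun z hz => ?_⟩
    erw [SimpleGraph.Walk.support_map, List.mem_map] at hz
    obtain ⟨a, -, rfl⟩ := hz
    exact a.2
  · rintro ⟨⟨x, hx⟩, h⟩
    refine SimpleGraph.induce_connected_of_patches x hx fun {v} hv => ?_
    obtain ⟨p, hp⟩ := h x hx v hv
    exact ⟨s, subset_rfl, hx, hv, ⟨p.induce s hp⟩⟩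

/-- A union of connected sets, indexed by a connected set of vertices of another graph along the
edges of which consecutive sets meet or are joined by an edge, is connected. -/
lemma connected_biUnion {W V : Type*} {H : SimpleGraph W} {G : SimpleGraph V} {T : Set W}
    {B : W → Set V} (hT : (H.induce T).Connected) (hB : ∀ w ∈ T, (G.induce (B w)).Connected)
    (hadj : ∀ w ∈ T, ∀ w' ∈ T, H.Adj w w' → ∃ x ∈ B w, ∃ y ∈ B w', x = y ∨ G.Adj x y) :
    (G.induce (⋃ w ∈ T, B w)).Connected := by
  rw [connected_induce_iff] at hT ⊢
  have hB' := fun w hw => connected_induce_iff.1 (hB w hw)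
  obtain ⟨⟨w₀, hw₀⟩, hT⟩ := hT
  obtain ⟨x₀, hx₀⟩ := (hB' w₀ hw₀).1
  have key : ∀ w w' (p : H.Walk w w'), (∀ z ∈ p.support, z ∈ T) → ∀ x ∈ B w, ∀ y ∈ B w',
      ∃ q : G.Walk x y, ∀ z ∈ q.support, z ∈ ⋃ w ∈ T, B w := by
    intro w w' p
    induction p with
    | nil =>
      intro hp x hx y hy
      have hw := hp _ (SimpleGraph.Walk.start_mem_support _)
      obtain ⟨q, hq⟩ := (hB' _ hw).2 x hx y hy
      exact ⟨q, fun z hz => Set.mem_biUnion hw (hq z hz)⟩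
    | @cons a b c h p ih =>
      intro hp x hx y hy
      have ha : a ∈ T := hp a (by simp)
      have hb : b ∈ T := hp b (by simp)
      obtain ⟨s, hs, t, ht, hst⟩ := hadj a ha b hb h
      obtain ⟨q₁, hq₁⟩ := (hB' a ha).2 x hx s hs
      obtain ⟨q₂, hq₂⟩ := ih (fun z hz => hp z (by simp [hz])) t ht y hy
      rcases hst with rfl | hst
      · refine ⟨q₁.append q₂, fun z hz => ?_⟩
        rw [SimpleGraph.Walk.mem_support_append_iff] at hz
        rcases hz with hz | hz
        · exact Set.mem_biUnion ha (hq₁ z hz)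
        · exact hq₂ z hz
      · refine ⟨q₁.append (.cons hst q₂), fun z hz => ?_⟩
        rw [SimpleGraph.Walk.mem_support_append_iff, SimpleGraph.Walk.support_cons,
          List.mem_cons] at hz
        rcases hz with hz | rfl | hz
        · exact Set.mem_biUnion ha (hq₁ z hz)
        · exact Set.mem_biUnion ha hs
        · exact hq₂ z hz
  refine ⟨⟨x₀, Set.mem_biUnion hw₀ hx₀⟩, fun x hx y hy => ?_⟩
  simp only [Set.mem_iUnion] at hx hy
  obtain ⟨w, hw, hx⟩ := hx
  obtain ⟨w', hw', hy⟩ := hy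
  obtain ⟨p, hp⟩ := hT w hw w' hw'
  exact key w w' p hp x hx y hy

lemma IsMinor.trans {U W V : Type*} {K : SimpleGraph U} {H : SimpleGraph W} {G : SimpleGraph V}
    (h₁ : IsMinor K H) (h₂ : IsMinor H G) : IsMinor K G := by
  obtain ⟨B, hB, hdB, haB⟩ := h₁
  obtain ⟨C, hC, hdC, haC⟩ := h₂
  refine ⟨fun u => ⋃ w ∈ B u, C w, fun u => ?_, fun u u' huu' => ?_, fun u u' huu' => ?_⟩
  · refine connected_biUnion (hB u) (fun w _ => hC w) fun w _ w' _ hww' => ?_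
    obtain ⟨x, hx, y, hy, hxy⟩ := haC w w' hww'
    exact ⟨x, hx, y, hy, .inr hxy⟩
  · rw [Set.disjoint_left]
    intro x hx hx'
    simp only [Set.mem_iUnion] at hx hx'
    obtain ⟨w, hw, hx⟩ := hx
    obtain ⟨w', hw', hx'⟩ := hx'
    have hne : w ≠ w' := fun h => Set.disjoint_left.1 (hdB u u' huu') hw (h ▸ hw')
    exact Set.disjoint_left.1 (hdC w w' hne) hx hx'
  · obtain ⟨w, hw, w', hw', hww'⟩ := haB u u' huu'
    obtain ⟨x, hx, y, hy, hxy⟩ := haC w w' hww'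
    exact ⟨x, Set.mem_biUnion hw hx, y, Set.mem_biUnion hw' hy, hxy⟩

lemma IsMinor.of_hom {W V : Type*} {H : SimpleGraph W} {G : SimpleGraph V} (f : W → V)
    (hf : Function.Injective f) (hadj : ∀ w w', H.Adj w w' → G.Adj (f w) (f w')) :
    IsMinor H G := by
  refine ⟨fun w => {f w}, fun w => ?_, fun w w' h => ?_, fun w w' h => ?_⟩
  · rw [connected_induce_iff]
    refine ⟨⟨_, rfl⟩, ?_⟩
    rintro x rfl y rfl
    exact ⟨.nil, by simp⟩
  · simpa using hf.ne h
  · exact ⟨_, rfl, _, rfl, hadj w w' h⟩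

lemma egirth_induce_le {V : Type*} (G : SimpleGraph V) (s : Set V) :
    G.egirth ≤ (G.induce s).egirth :=
  SimpleGraph.IsContained.egirth_le ⟨SimpleGraph.Copy.induce G s⟩

/-- Two adjacent vertices joined by a second walk, avoiding their edge, lie on a short cycle. -/
lemma egirth_le_of_walk {V : Type*} {G K : SimpleGraph V} {u v : V} (huv : G.Adj u v)
    (hK : K ≤ G) (hKuv : ¬ K.Adj u v) (p : K.Walk u v) : G.egirth ≤ (p.length + 1 : ℕ) := by
  classical
  let q := (p.bypass).mapLe hK
  have hq : q.IsPath := (SimpleGraph.Walk.isPath_mapLe hK).2 p.bypass_isPath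
  have he : s(v, u) ∉ q.edges := by
    intro h
    have h' : s(v, u) ∈ p.bypass.edges := by simpa [q] using h
    have := p.bypass.adj_of_mem_edges h'
    exact hKuv this.symm
  have hc : (SimpleGraph.Walk.cons huv.symm q).IsCycle :=
    (SimpleGraph.Walk.cons_isCycle_iff _ _).2 ⟨hq, he⟩
  refine (SimpleGraph.egirth_le_length hc).trans ?_
  have := p.length_bypass_le_length
  simp only [SimpleGraph.Walk.length_cons, q, SimpleGraph.Walk.length_map, SimpleGraph.Walk.mapLe]
  exact_mod_cast Nat.succ_le_succ this

/-- Distance layers around a set `X`: every vertex joined to `X` gets a finite distance `δ`, which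
changes by at most one along an edge and decreases along some edge. -/
lemma exists_layers {V : Type*} (K : SimpleGraph V) (X : Set V) :
    ∃ δ : V → ℕ, (∀ x ∈ X, δ x = 0) ∧
      (∀ v x, x ∈ X → ∀ p : K.Walk v x, δ v ≤ p.length) ∧
      (∀ v, (∃ x ∈ X, K.Reachable v x) → v ∉ X → ∃ u, K.Adj v u ∧ δ u + 1 = δ v) ∧
      ∀ v w, (∃ x ∈ X, K.Reachable v x) → K.Adj v w → δ w ≤ δ v + 1 := by
  classical
  let P : V → ℕ → Prop := fun v n => ∃ x ∈ X, ∃ p : K.Walk v x, p.length = n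
  let δ : V → ℕ := fun v => sInf {n | P v n}
  have hle : ∀ v x, x ∈ X → ∀ p : K.Walk v x, δ v ≤ p.length :=
    fun v x hx p => Nat.sInf_le ⟨x, hx, p, rfl⟩
  have hmem : ∀ v, (∃ x ∈ X, K.Reachable v x) → P v (δ v) := by
    rintro v ⟨x, hx, ⟨p⟩⟩
    exact Nat.sInf_mem (s := {n | P v n}) ⟨_, x, hx, p, rfl⟩
  refine ⟨δ, fun x hx => Nat.le_zero.1 (hle x x hx .nil), hle, fun v hv hvX => ?_,
    fun v w hv hvw => ?_⟩
  · obtain ⟨x, hx, p, hp⟩ := hmem v hv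
    cases p with
    | nil => exact absurd hx hvX
    | @cons _ u _ h p =>
      refine ⟨u, h, ?_⟩
      have h1 := hle u x hx p
      obtain ⟨y, hy, q, hq⟩ := hmem u ⟨x, hx, ⟨p⟩⟩
      have h2 := hle v y hy (.cons h q)
      simp only [SimpleGraph.Walk.length_cons] at hp h2
      omega
  · obtain ⟨x, hx, p, hp⟩ := hmem v hv
    have := hle w x hx (.cons hvw.symm p)
    simpa [hp] using this

/-! ### Dense graphs have large complete minors -/

open Classical in
/-- The number of ordered pairs of adjacent vertices in `S`, twice the number of edges inside `S`. -/
noncomputable def dartCount {V : Type*} (H : SimpleGraph V) (S : Finset V) : ℕ :=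
  ((S ×ˢ S).filter fun p => H.Adj p.1 p.2).card

/-- A model of the complete graph on `t` vertices in `H`, inside `S`, all of whose branch sets have
at least two vertices. -/
def HasFatModel {V : Type*} (H : SimpleGraph V) (S : Set V) (t : ℕ) : Prop :=
  ∃ B : Fin t → Set V, (∀ i, B i ⊆ S) ∧ (∀ i, (H.induce (B i)).Connected) ∧
    (∀ i, (B i).Nontrivial) ∧ (∀ i j, i ≠ j → Disjoint (B i) (B j)) ∧
    ∀ i j, i ≠ j → ∃ x ∈ B i, ∃ y ∈ B j, H.Adj x y

lemma HasFatModel.mono {V : Type*} {H : SimpleGraph V} {S S' : Set V} {t : ℕ}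
    (h : HasFatModel H S t) (hS : S ⊆ S') : HasFatModel H S' t := by
  obtain ⟨B, h1, h2⟩ := h
  exact ⟨B, fun i => (h1 i).trans hS, h2⟩

lemma connected_induce_mono {V : Type*} {H K : SimpleGraph V} (h : H ≤ K) {s : Set V}
    (hs : (H.induce s).Connected) : (K.induce s).Connected :=
  hs.mono fun _ _ hab => h hab

/-- A further branch set, adjacent to all vertices of a set `L` that every old branch set meets. -/
lemma HasFatModel.cons {V : Type*} {H C : SimpleGraph V} {S P L U : Set V} {t : ℕ}
    (h : HasFatModel C P t) (hC : C ≤ H) (hPS : P ⊆ S) (hUS : U ⊆ S)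
    (hU : (H.induce U).Connected) (hU2 : U.Nontrivial) (hUP : Disjoint U P)
    (hL : ∀ x y, C.Adj x y → x ∈ L ∨ y ∈ L) (hLU : ∀ x ∈ L, x ∈ P → ∃ y ∈ U, H.Adj y x) :
    HasFatModel H S (t + 1) := by
  obtain ⟨B, hBP, hBc, hB2, hBd, hBa⟩ := h
  have hmeet : ∀ j, ∃ y ∈ U, ∃ x ∈ B j, H.Adj y x := by
    intro j
    obtain ⟨x, hx, y, hy, hxy⟩ := hB2 j
    obtain ⟨p, hp⟩ := (connected_induce_iff.1 (hBc j)).2 x hx y hy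
    cases p with
    | nil => exact absurd rfl hxy
    | @cons _ z _ hxz p =>
      have hz : z ∈ B j := hp z (by simp)
      rcases hL x z hxz with hl | hl
      · obtain ⟨w, hw, h⟩ := hLU x hl (hBP j hx)
        exact ⟨w, hw, x, hx, h⟩
      · obtain ⟨w, hw, h⟩ := hLU z hl (hBP j hz)
        exact ⟨w, hw, z, hz, h⟩
  refine ⟨Fin.cons U B, fun i => ?_, fun i => ?_, fun i => ?_, fun i j => ?_, fun i j => ?_⟩
  · cases i using Fin.cases with
    | zero => simpa using hUS
    | succ i => simpa using (hBP i).trans hPS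
  · cases i using Fin.cases with
    | zero => exact hU
    | succ i => exact connected_induce_mono hC (hBc i)
  · cases i using Fin.cases with
    | zero => simpa using hU2
    | succ i => simpa using hB2 i
  · cases i using Fin.cases with
    | zero =>
      cases j using Fin.cases with
      | zero => simp
      | succ j => simpa using fun _ => hUP.mono_right (hBP j)
    | succ i =>
      cases j using Fin.cases with
      | zero => simpa using (hUP.mono_right (hBP i)).symm
      | succ j => simpa using hBd i j
  · cases i using Fin.cases with
    | zero =>
      cases j using Fin.cases with
      | zero => simp
      | succ j => intro _; simpa using hmeet j
    | succ i =>
      cases j using Fin.cases with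
      | zero =>
        intro _
        obtain ⟨y, hy, x, hx, h⟩ := hmeet i
        simpa using ⟨x, hx, y, hy, h.symm⟩
      | succ j =>
        intro hij
        obtain ⟨x, hx, y, hy, h⟩ := hBa i j (by simpa using hij)
        simpa using ⟨x, hx, y, hy, hC h⟩

/-- Among the bipartite-like pieces cut out by consecutive layers of `δ`, one is at least half as
dense as the whole. -/
lemma exists_dense_layer {V : Type*} {H : SimpleGraph V} {S : Finset V} {d : ℕ} {δ : V → ℕ}
    (hS : 2 * d * S.card < dartCount H S)
    (hδ : ∀ x ∈ S, ∀ y ∈ S, H.Adj x y → δ y ≤ δ x + 1) :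
    ∃ (i : ℕ) (C : SimpleGraph V) (P : Finset V), C ≤ H ∧ P ⊆ S ∧
      (∀ x y, C.Adj x y → δ x = i ∨ δ y = i) ∧ (∀ x ∈ P, i ≤ δ x) ∧ d * P.card < dartCount C P := by
  classical
  let C : ℕ → SimpleGraph V := fun i =>
    { Adj := fun x y => H.Adj x y ∧ min (δ x) (δ y) = i
      symm := ⟨fun x y h => ⟨h.1.symm, by rw [min_comm]; exact h.2⟩⟩
      loopless := ⟨fun x h => H.loopless.irrefl x h.1⟩ }
  let P : ℕ → Finset V := fun i => S.filter fun x => δ x = i ∨ δ x = i + 1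
  by_contra hcon
  push Not at hcon
  have hle : ∀ i, dartCount (C i) (P i) ≤ d * (P i).card := fun i =>
    hcon i (C i) (P i) (fun x y h => h.1) (Finset.filter_subset _ _)
      (fun x y h => by have := h.2; omega)
      (fun x hx => by have := (Finset.mem_filter.1 hx).2; omega)
  obtain ⟨M, hM⟩ : ∃ M, ∀ x ∈ S, δ x < M := by
    refine ⟨S.sup δ + 1, fun x hx => Nat.lt_succ_of_le (Finset.le_sup hx)⟩
  have h1 : dartCount H S ≤ ∑ i ∈ Finset.range M, dartCount (C i) (P i) := by
    unfold dartCount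
    refine le_trans (Finset.card_le_card ?_) Finset.card_biUnion_le
    rintro ⟨x, y⟩ hxy
    simp only [Finset.mem_filter, Finset.mem_product] at hxy
    obtain ⟨⟨hx, hy⟩, hxy⟩ := hxy
    have h1 := hδ x hx y hy hxy
    have h2 := hδ y hy x hx hxy.symm
    have h3 := hM x hx
    simp only [Finset.mem_biUnion, Finset.mem_range, Finset.mem_filter, Finset.mem_product]
    refine ⟨min (δ x) (δ y), by omega, ⟨?_, ?_⟩, hxy, rfl⟩
    · exact Finset.mem_filter.2 ⟨hx, by omega⟩
    · exact Finset.mem_filter.2 ⟨hy, by omega⟩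
  have hfib : ∀ k, ∑ i ∈ Finset.range M, (S.filter fun x => δ x = i + k).card ≤ S.card := by
    intro k
    rw [← Finset.card_biUnion]
    · exact Finset.card_le_card (Finset.biUnion_subset.2 fun _ _ => Finset.filter_subset _ _)
    · intro i _ j _ hij
      rw [Function.onFun, Finset.disjoint_left]
      intro x hx hx'
      have h1 := (Finset.mem_filter.1 hx).2
      have h2 := (Finset.mem_filter.1 hx').2
      omega
  have hP : ∀ i, (P i).card ≤
      (S.filter fun x => δ x = i).card + (S.filter fun x => δ x = i + 1).card := by
    intro i
    simp only [P, Finset.filter_or]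
    exact Finset.card_union_le _ _
  have h3 : ∑ i ∈ Finset.range M, (P i).card ≤ 2 * S.card := by
    refine (Finset.sum_le_sum fun i _ => hP i).trans ?_
    rw [Finset.sum_add_distrib, two_mul]
    exact add_le_add (hfib 0) (hfib 1)
  have h4 : dartCount H S ≤ d * (2 * S.card) := by
    refine h1.trans ((Finset.sum_le_sum fun i _ => hle i).trans ?_)
    rw [← Finset.mul_sum]
    exact Nat.mul_le_mul_left d h3
  have : d * (2 * S.card) = 2 * d * S.card := by ring
  omega

/-- A graph of large average degree has a model of a large complete graph. Its edges are cut into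
the pieces between consecutive layers around an edge; a dense piece has a model by induction, every
branch set of which meets the lower layer, and the union of the layers below is one more branch
set. -/
lemma hasFatModel_of_dense {V : Type*} (t : ℕ) : ∀ (H : SimpleGraph V) (S : Finset V),
    4 * 2 ^ t * S.card < dartCount H S → HasFatModel H (S : Set V) t := by
  classical
  induction t with
  | zero =>
    intro H S _
    exact ⟨fun i => i.elim0, fun i => i.elim0, fun i => i.elim0, fun i => i.elim0,
      fun i => i.elim0, fun i => i.elim0⟩
  | succ t ih =>
    intro H S
    induction S using Finset.strongInduction with
    | H S ihS =>
    intro hS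
    by_cases hmin : ∃ S', S' ⊂ S ∧ 4 * 2 ^ (t + 1) * S'.card < dartCount H S'
    · obtain ⟨S', h1, h2⟩ := hmin
      exact (ihS S' h1 h2).mono (by exact_mod_cast h1.1)
    push Not at hmin
    obtain ⟨r₀, hr₀, r₁, hr₁, hr⟩ : ∃ x ∈ S, ∃ y ∈ S, H.Adj x y := by
      have : 0 < dartCount H S := by omega
      obtain ⟨⟨x, y⟩, h⟩ := Finset.card_pos.1 this
      simp only [Finset.mem_filter, Finset.mem_product] at h
      exact ⟨x, h.1.1, y, h.1.2, h.2⟩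
    let K : SimpleGraph V :=
      { Adj := fun x y => H.Adj x y ∧ x ∈ S ∧ y ∈ S
        symm := ⟨fun x y h => ⟨h.1.symm, h.2.2, h.2.1⟩⟩
        loopless := ⟨fun x h => H.loopless.irrefl x h.1⟩ }
    -- By minimality, `S` is connected.
    have hconn : ∀ x ∈ S, K.Reachable x r₀ := by
      by_contra hcon
      push Not at hcon
      obtain ⟨x, hx, hxr⟩ := hcon
      let R := S.filter fun x => K.Reachable x r₀
      have hRS : R ⊂ S := by
        refine Finset.filter_ssubset.2 ⟨x, hx, hxr⟩
      have hRS' : S \ R ⊂ S := by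
        refine Finset.sdiff_ssubset hRS.1 ⟨r₀, Finset.mem_filter.2 ⟨hr₀, .refl _⟩⟩
      have h1 := hmin R hRS
      have h2 := hmin _ hRS'
      have h3 : dartCount H S ≤ dartCount H R + dartCount H (S \ R) := by
        unfold dartCount
        refine le_trans (Finset.card_le_card ?_) (Finset.card_union_le _ _)
        rintro ⟨x, y⟩ hxy
        simp only [Finset.mem_filter, Finset.mem_product] at hxy
        obtain ⟨⟨hx, hy⟩, hxy⟩ := hxy
        have hK : K.Adj x y := ⟨hxy, hx, hy⟩
        have hiff : K.Reachable x r₀ ↔ K.Reachable y r₀ :=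
          ⟨fun h => hK.symm.reachable.trans h, fun h => hK.reachable.trans h⟩
        simp only [Finset.mem_union, Finset.mem_filter, Finset.mem_product, Finset.mem_sdiff, R]
        tauto
      have h4 : (S \ R).card + R.card = S.card := Finset.card_sdiff_add_card_eq_card hRS.1
      rw [← h4, mul_add] at hS
      omega
    obtain ⟨δ, hδ0, -, hδdown, hδadj⟩ := exists_layers K {r₀, r₁}
    have hreach : ∀ x ∈ S, ∃ y ∈ ({r₀, r₁} : Set V), K.Reachable x y :=
      fun x hx => ⟨r₀, by simp, hconn x hx⟩
    obtain ⟨i, C, P, hCH, hPS, hCi, hPi, hdense⟩ :=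
      exists_dense_layer (H := H) (S := S) (d := 4 * 2 ^ t) (δ := δ)
        (by rw [pow_succ] at hS; convert hS using 2; ring)
        (fun x hx y hy h => hδadj x y (hreach x hx) ⟨h, hx, hy⟩)
    have hzero : ∀ x ∈ S, δ x = 0 → x = r₀ ∨ x = r₁ := by
      intro x hx h0
      by_contra hne
      obtain ⟨u, -, hu⟩ := hδdown x (hreach x hx) (by simpa using hne)
      omega
    -- The piece around the edge `r₀ r₁` is the union of two stars, hence sparse.
    have hi : i ≠ 0 := by
      rintro rfl
      have h1 : dartCount C P ≤ 2 * P.card + P.card * 2 := by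
        have h2 : ({r₀, r₁} : Finset V).card ≤ 2 := Finset.card_le_two
        calc dartCount C P
            ≤ ((({r₀, r₁} : Finset V) ×ˢ P) ∪ (P ×ˢ ({r₀, r₁} : Finset V))).card := by
              refine Finset.card_le_card ?_
              rintro ⟨x, y⟩ hxy
              simp only [Finset.mem_filter, Finset.mem_product] at hxy
              obtain ⟨⟨hx, hy⟩, hxy⟩ := hxy
              have := hzero x (hPS hx)
              have := hzero y (hPS hy)
              have := hCi x y hxy
              simp only [Finset.mem_union, Finset.mem_product, Finset.mem_insert,
                Finset.mem_singleton]
              tauto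
          _ ≤ _ := by
              refine (Finset.card_union_le _ _).trans ?_
              rw [Finset.card_product, Finset.card_product]
              gcongr
      have h2 : 4 * P.card ≤ 4 * 2 ^ t * P.card :=
        Nat.mul_le_mul_right _ (Nat.le_mul_of_pos_right 4 (by positivity))
      omega
    have hU : ∀ n, ∀ x ∈ S, δ x = n → n < i →
        ∃ p : H.Walk x r₀, ∀ z ∈ p.support, z ∈ {x | x ∈ S ∧ δ x < i} := by
      intro n
      induction n with
      | zero =>
        intro x hx h0 hi0
        have hr₀' : δ r₀ = 0 := hδ0 r₀ (by simp)
        rcases hzero x hx h0 with rfl | rfl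
        · exact ⟨.nil, by simp [hx, h0, hi0]⟩
        · exact ⟨.cons hr.symm .nil, by simp [hx, h0, hi0, hr₀, hr₀']⟩
      | succ n ihn =>
        intro x hx hxn hni
        have hxX : x ∉ ({r₀, r₁} : Set V) := fun h => by have := hδ0 x h; omega
        obtain ⟨u, hu, hun⟩ := hδdown x (hreach x hx) hxX
        obtain ⟨p, hp⟩ := ihn u hu.2.2 (by omega) (by omega)
        refine ⟨.cons hu.1 p, fun z hz => ?_⟩
        rw [SimpleGraph.Walk.support_cons, List.mem_cons] at hz
        rcases hz with rfl | hz
        · exact ⟨hx, by omega⟩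
        · exact hp z hz
    have hrU : ∀ x, x = r₀ ∨ x = r₁ → x ∈ {x | x ∈ S ∧ δ x < i} := by
      intro x hx
      refine ⟨by rcases hx with rfl | rfl <;> assumption, ?_⟩
      rw [hδ0 x (by simpa using hx)]
      omega
    refine HasFatModel.cons (L := {x | δ x = i}) (U := {x | x ∈ S ∧ δ x < i})
      (ih C P hdense) hCH (by exact_mod_cast hPS) (fun x hx => hx.1) ?_ ?_ ?_ hCi ?_
    · refine connected_induce_iff.2 ⟨⟨r₀, hrU _ (.inl rfl)⟩, fun x hx y hy => ?_⟩
      obtain ⟨p, hp⟩ := hU _ x hx.1 rfl hx.2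
      obtain ⟨q, hq⟩ := hU _ y hy.1 rfl hy.2
      refine ⟨p.append q.reverse, fun z hz => ?_⟩
      rw [SimpleGraph.Walk.mem_support_append_iff, SimpleGraph.Walk.support_reverse,
        List.mem_reverse] at hz
      exact hz.elim (hp z) (hq z)
    · exact ⟨r₀, hrU _ (.inl rfl), r₁, hrU _ (.inr rfl), hr.ne⟩
    · rw [Set.disjoint_left]
      intro x hx hxP
      have := hPi x hxP
      have := hx.2
      omega
    · intro x hx hxP
      have hxX : x ∉ ({r₀, r₁} : Set V) := fun h => by
        have := hδ0 x h
        have : δ x = i := hx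
        omega
      obtain ⟨u, hu, hun⟩ := hδdown x (hreach x (hPS hxP)) hxX
      have : δ x = i := hx
      exact ⟨u, ⟨hu.2.2, by omega⟩, hu.1.symm⟩

/-! ### Reducible configurations in graphs of large girth -/

/-- `G` has a vertex of degree at most one, or a path `s 0, …, s 5` all of whose inner vertices have
no neighbors but the two next ones on the path. The path is the beginning of an infinite walk, which
is no restriction and spares a bound on the indices. -/
def IsReducible {V : Type*} (G : SimpleGraph V) : Prop :=
  (∃ v, ∀ y z, G.Adj v y → G.Adj v z → y = z) ∨
  ∃ s : ℕ → V, Set.InjOn s (Set.Icc 0 5) ∧ (∀ j, G.Adj (s j) (s (j + 1))) ∧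
    ∀ j ∈ Set.Icc 1 4, ∀ y, G.Adj (s j) y → y = s (j - 1) ∨ y = s (j + 1)

/-- Without vertices of degree at most one, a walk never has to turn back. -/
lemma exists_nonbacktracking {V : Type*} {G : SimpleGraph V}
    (h2 : ∀ v a, ∃ b, G.Adj v b ∧ b ≠ a) (x : V) :
    ∃ s : ℕ → V, s 0 = x ∧ (∀ n, G.Adj (s n) (s (n + 1))) ∧ ∀ n, s (n + 2) ≠ s n := by
  choose nxt hadj hne using h2
  let f : ℕ → V × V := fun n => (fun q : V × V => (q.2, nxt q.2 q.1))^[n] (x, x)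
  have hf : ∀ n, f (n + 1) = ((f n).2, nxt (f n).2 (f n).1) := fun n =>
    Function.iterate_succ_apply' _ _ _
  refine ⟨fun n => (f n).2, rfl, fun n => ?_, fun n => ?_⟩
  · simp only [hf n]
    exact hadj _ _
  · simp only [hf (n + 1), hf n]
    exact hne _ _

lemma exists_walk_of_seq {V : Type*} {K : SimpleGraph V} {s : ℕ → V} (a n : ℕ)
    (h : ∀ k < n, K.Adj (s (a + k)) (s (a + k + 1))) :
    ∃ p : K.Walk (s a) (s (a + n)), p.length = n := by
  induction n with
  | zero => exact ⟨.nil, rfl⟩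
  | succ n ih =>
    obtain ⟨p, hp⟩ := ih fun k hk => h k (by omega)
    exact ⟨p.concat (h n (by omega)), by simp [hp]⟩

/-- A nonbacktracking walk shorter than the girth does not revisit a vertex. -/
lemma nonbacktracking_ne {V : Type*} {G : SimpleGraph V} {s : ℕ → V}
    (hadj : ∀ n, G.Adj (s n) (s (n + 1))) (hne : ∀ n, s (n + 2) ≠ s n) (d : ℕ) :
    0 < d → (d : ℕ∞) < G.egirth → ∀ i, s i ≠ s (i + d) := by
  induction d using Nat.strong_induction_on with
  | _ d ih =>
  intro hd hg i hi
  have ih' : ∀ a b, a < b → b < a + d → s a ≠ s b := by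
    intro a b hab hbd h
    refine ih (b - a) (by omega) (by omega) (lt_trans ?_ hg) a ?_
    · exact_mod_cast (by omega : b - a < d)
    · rw [h]; congr 1; omega
  obtain ⟨e, rfl⟩ : ∃ e, d = e + 1 := ⟨d - 1, by omega⟩
  let K := G.deleteEdges {s(s (i + 1), s i)}
  obtain ⟨p, hp⟩ := exists_walk_of_seq (K := K) (s := s) (i + 1) e fun k hk => by
    refine SimpleGraph.deleteEdges_adj.2 ⟨hadj _, ?_⟩
    rw [Set.mem_singleton_iff, Sym2.eq_iff]
    rintro (⟨h1, h2⟩ | ⟨h1, h2⟩)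
    · rcases Nat.eq_zero_or_pos k with rfl | hk0
      · exact hne i h2
      · exact ih' (i + 1) (i + 1 + k) (by omega) (by omega) h1.symm
    · exact ih' i (i + 1 + k) (by omega) (by omega) h1.symm
  have hend : s (i + 1 + e) = s i := by rw [hi]; congr 1; omega
  have := egirth_le_of_walk (hadj i).symm (K := K) (SimpleGraph.deleteEdges_le _)
    (fun h => (SimpleGraph.deleteEdges_adj.1 h).2 rfl) (p.copy rfl hend)
  rw [SimpleGraph.Walk.length_copy, hp] at this
  exact absurd hg (not_lt.2 this)

/-- Without reducible configurations, a ball of radius `4 * D` around any vertex contains `D`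
vertices of degree at least three. -/
lemma exists_branching {V : Type*} {G : SimpleGraph V} (hG : ¬ IsReducible G) (D : ℕ)
    (hg : ((4 * D + 10 : ℕ) : ℕ∞) < G.egirth) (x : V) :
    ∃ T : Finset V, T.card = D ∧ ∀ v ∈ T, (∃ p : G.Walk x v, p.length ≤ 4 * D) ∧
      ∃ a b c, a ≠ b ∧ a ≠ c ∧ b ≠ c ∧ G.Adj v a ∧ G.Adj v b ∧ G.Adj v c := by
  classical
  unfold IsReducible at hG
  push Not at hG
  obtain ⟨hdeg, hpath⟩ := hG
  have h2 : ∀ v a, ∃ b, G.Adj v b ∧ b ≠ a := by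
    intro v a
    obtain ⟨y, z, hy, hz, hyz⟩ := hdeg v
    by_cases hya : y = a
    · exact ⟨z, hz, fun h => hyz (hya.trans h.symm)⟩
    · exact ⟨y, hy, hya⟩
  obtain ⟨s, rfl, hadj, hne⟩ := exists_nonbacktracking h2 x
  have hinj : ∀ i j, i < j → j ≤ i + (4 * D + 10) → s i ≠ s j := by
    intro i j hij hj
    have := nonbacktracking_ne hadj hne (j - i) (by omega)
      (lt_of_le_of_lt (by exact_mod_cast (by omega : j - i ≤ 4 * D + 10)) hg) i
    rwa [show i + (j - i) = j by omega] at this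
  -- Any four consecutive vertices of the walk contain one with a neighbor off the walk.
  have hblock : ∀ k, ∃ j ∈ Set.Icc 1 4, ∃ y, G.Adj (s (4 * k + j)) y ∧
      y ≠ s (4 * k + (j - 1)) ∧ y ≠ s (4 * k + (j + 1)) := by
    intro k
    refine hpath (fun j => s (4 * k + j)) (fun i hi j hj hij => ?_) fun j => hadj _
    by_contra hne
    rcases lt_or_gt_of_ne hne with h | h
    · exact hinj _ _ (by omega) (by have := hj.2; omega) hij
    · exact hinj _ _ (by omega) (by have := hi.2; omega) hij.symm
  choose j hj y hy hy1 hy2 using hblock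
  refine ⟨(Finset.range D).image fun k => s (4 * k + j k), ?_, fun v hv => ?_⟩
  · rw [Finset.card_image_of_injOn, Finset.card_range]
    intro a ha b hb hab
    have ha' : a < D := by simpa using ha
    have hb' : b < D := by simpa using hb
    have := (hj a).1; have := (hj a).2; have := (hj b).1; have := (hj b).2
    by_contra hne
    rcases lt_or_gt_of_ne hne with h | h
    · exact hinj _ _ (by omega) (by omega) hab
    · exact hinj _ _ (by omega) (by omega) hab.symm
  · obtain ⟨k, hk, rfl⟩ := Finset.mem_image.1 hv
    have hk' : k < D := by simpa using hk
    have h1 := (hj k).1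
    have h4 := (hj k).2
    constructor
    · obtain ⟨p, hp⟩ := exists_walk_of_seq (K := G) (s := s) 0 (4 * k + j k) fun _ _ => hadj _
      exact ⟨p.copy rfl (by rw [zero_add]), by rw [SimpleGraph.Walk.length_copy]; omega⟩
    · refine ⟨s (4 * k + (j k - 1)), s (4 * k + (j k + 1)), y k, ?_, (hy1 k).symm, (hy2 k).symm,
        ?_, hadj _, hy k⟩
      · exact hinj _ _ (by omega) (by omega)
      · have := (hadj (4 * k + (j k - 1))).symm
        rwa [show 4 * k + (j k - 1) + 1 = 4 * k + j k by omega] at this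

/-- A partition of the vertices into trees around the centers in `X`: `par` moves each vertex one
step towards its center `ctr`. -/
structure Voronoi {V : Type*} (G : SimpleGraph V) (X : Finset V) (r : ℕ) where
  par : V → V
  ctr : V → V
  par_of_mem : ∀ v ∈ X, par v = v
  adj_par : ∀ v ∉ X, G.Adj v (par v)
  ctr_mem : ∀ v, ctr v ∈ X
  ctr_of_mem : ∀ v ∈ X, ctr v = v
  ctr_par : ∀ v, ctr (par v) = ctr v
  iterate_par : ∀ v, par^[r] v = ctr v
  ctr_near : ∀ v, ∃ p : G.Walk v (ctr v), ∀ x ∈ X, ∀ q : G.Walk v x, p.length ≤ q.length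

/-- Every vertex moves along a shortest path to the set of centers, one step at a time; after `r`
steps it has arrived, and stays there. -/
lemma exists_voronoi {V : Type*} (G : SimpleGraph V) (X : Finset V) (r : ℕ)
    (hX : ∀ v, ∃ x ∈ X, ∃ p : G.Walk v x, p.length ≤ r) : Nonempty (Voronoi G X r) := by
  classical
  obtain ⟨δ, hδ0, hδle, hδdown, -⟩ := exists_layers G (X : Set V)
  have hreach : ∀ v, ∃ x ∈ (X : Set V), G.Reachable v x := fun v => by
    obtain ⟨x, hx, p, -⟩ := hX v
    exact ⟨x, hx, ⟨p⟩⟩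
  have hpar : ∀ v, ∃ u, (v ∈ X → u = v) ∧ (v ∉ X → G.Adj v u ∧ δ u + 1 = δ v) := by
    intro v
    by_cases hv : v ∈ X
    · exact ⟨v, fun _ => rfl, fun h => absurd hv h⟩
    · obtain ⟨u, hu⟩ := hδdown v (hreach v) (by simpa using hv)
      exact ⟨u, fun h => absurd h hv, fun _ => hu⟩
  choose par hpX hpN using hpar
  have hfix : ∀ n, ∀ v ∈ X, par^[n] v = v := fun n v hv => Function.iterate_fixed (hpX v hv) n
  have hdep : ∀ n v, δ v = n → par^[n] v ∈ X ∧ ∃ p : G.Walk v (par^[n] v), p.length ≤ n := by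
    intro n
    induction n with
    | zero =>
      intro v hv
      refine ⟨?_, .nil, by simp⟩
      by_contra h
      have := (hpN v h).2
      omega
    | succ n ih =>
      intro v hv
      have hvX : v ∉ X := fun h => by have := hδ0 v h; omega
      have h := hpN v hvX
      obtain ⟨h1, p, hp⟩ := ih (par v) (by omega)
      exact ⟨h1, .cons h.1 p, by simpa using hp⟩
  have hδr : ∀ v, δ v ≤ r := by
    intro v
    obtain ⟨x, hx, p, hp⟩ := hX v
    exact (hδle v x hx p).trans hp
  have hiter : ∀ v, par^[r] v = par^[δ v] v := by
    intro v
    obtain ⟨k, hk⟩ := Nat.exists_eq_add_of_le (hδr v)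
    rw [hk, add_comm, Function.iterate_add_apply]
    exact hfix k _ (hdep _ v rfl).1
  exact ⟨{
    par := par
    ctr := par^[r]
    par_of_mem := hpX
    adj_par := fun v hv => (hpN v hv).1
    ctr_mem := fun v => by rw [hiter v]; exact (hdep _ v rfl).1
    ctr_of_mem := hfix r
    ctr_par := fun v => by
      rw [← Function.iterate_succ_apply, Function.iterate_succ_apply']
      exact hpX _ (by rw [hiter v]; exact (hdep _ v rfl).1)
    iterate_par := fun v => rfl
    ctr_near := fun v => by
      obtain ⟨-, p, hp⟩ := hdep _ v rfl
      refine ⟨p.copy rfl (hiter v).symm, fun x hx q => ?_⟩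
      rw [SimpleGraph.Walk.length_copy]
      exact hp.trans (hδle v x hx q) }⟩

namespace Voronoi

variable {V : Type*} {G : SimpleGraph V} {X : Finset V} {r : ℕ}

/-- The forest formed by the edges between the vertices and their parents. -/
def tree (P : Voronoi G X r) : SimpleGraph V where
  Adj u v := u ≠ v ∧ (v = P.par u ∨ u = P.par v)
  symm := ⟨fun _ _ h => ⟨h.1.symm, h.2.symm⟩⟩
  loopless := ⟨fun _ h => h.1 rfl⟩

/-- The graph on the centers obtained by contracting every tree of the partition. -/
def contract (P : Voronoi G X r) : SimpleGraph V where
  Adj x y := x ≠ y ∧ ∃ u v, G.Adj u v ∧ P.ctr u = x ∧ P.ctr v = y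
  symm := ⟨fun _ _ ⟨h, u, v, huv, hu, hv⟩ => ⟨h.symm, v, u, huv.symm, hv, hu⟩⟩
  loopless := ⟨fun _ h => h.1 rfl⟩

lemma tree_adj (P : Voronoi G X r) {u v : V} (h : P.tree.Adj u v) :
    (u ∉ X ∧ v = P.par u) ∨ (v ∉ X ∧ u = P.par v) := by
  obtain ⟨hne, h | h⟩ := h
  · exact .inl ⟨fun hu => hne (by rw [h, P.par_of_mem u hu]), h⟩
  · exact .inr ⟨fun hv => hne (by rw [h, P.par_of_mem v hv]), h⟩

lemma tree_le (P : Voronoi G X r) : P.tree ≤ G := by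
  intro u v h
  rcases P.tree_adj h with ⟨h1, rfl⟩ | ⟨h1, rfl⟩
  · exact P.adj_par u h1
  · exact (P.adj_par v h1).symm

lemma exists_tree_walk (P : Voronoi G X r) (v : V) :
    ∃ p : P.tree.Walk v (P.ctr v), p.length ≤ r := by
  have : ∀ n v, ∃ p : P.tree.Walk v (P.par^[n] v), p.length ≤ n := by
    intro n
    induction n with
    | zero => exact fun v => ⟨.nil, le_rfl⟩
    | succ n ih =>
      intro v
      obtain ⟨p, hp⟩ := ih (P.par v)
      rw [Function.iterate_succ_apply]
      by_cases hv : v = P.par v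
      · exact ⟨p.copy hv.symm rfl, by rw [SimpleGraph.Walk.length_copy]; omega⟩
      · have h : P.tree.Adj v (P.par v) := ⟨hv, .inl rfl⟩
        exact ⟨.cons h p, by simpa using hp⟩
  obtain ⟨p, hp⟩ := this r v
  exact ⟨p.copy rfl (P.iterate_par v), by simpa using hp⟩

lemma ctr_eq_of_tree_walk (P : Voronoi G X r) {u v : V} (p : P.tree.Walk u v) :
    ∀ z ∈ p.support, P.ctr z = P.ctr u := by
  induction p with
  | nil => simp
  | @cons a b c h p ih =>
    have hab : P.ctr b = P.ctr a := by
      rcases h.2 with rfl | rfl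
      · exact P.ctr_par a
      · exact (P.ctr_par b).symm
    intro z hz
    rw [SimpleGraph.Walk.support_cons, List.mem_cons] at hz
    rcases hz with rfl | hz
    · rfl
    · exact (ih z hz).trans hab

lemma connected_fiber (P : Voronoi G X r) {x : V} (hx : x ∈ X) :
    (G.induce {v | P.ctr v = x}).Connected := by
  have key : ∀ v, P.ctr v = x → ∃ p : G.Walk v x, ∀ z ∈ p.support, P.ctr z = x := by
    rintro v rfl
    obtain ⟨p, -⟩ := P.exists_tree_walk v
    refine ⟨p.mapLe P.tree_le, fun z hz => P.ctr_eq_of_tree_walk p z ?_⟩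
    simpa using hz
  refine connected_induce_iff.2 ⟨⟨x, P.ctr_of_mem x hx⟩, fun u hu v hv => ?_⟩
  obtain ⟨p, hp⟩ := key u hu
  obtain ⟨q, hq⟩ := key v hv
  refine ⟨p.append q.reverse, fun z hz => ?_⟩
  rw [SimpleGraph.Walk.mem_support_append_iff, SimpleGraph.Walk.support_reverse,
    List.mem_reverse] at hz
  exact hz.elim (hp z) (hq z)

lemma isMinor_of_hasFatModel (P : Voronoi G X r) {t : ℕ}
    (h : HasFatModel P.contract (X : Set V) t) : IsMinor (⊤ : SimpleGraph (Fin t)) G := by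
  obtain ⟨B, hBX, hBc, -, hBd, hBa⟩ := h
  refine ⟨fun i => ⋃ w ∈ B i, {v | P.ctr v = w}, fun i => ?_, fun i j hij => ?_,
    fun i j hij => ?_⟩
  · refine connected_biUnion (hBc i) (fun w hw => P.connected_fiber (hBX i hw))
      fun w _ w' _ hww' => ?_
    obtain ⟨-, u, v, huv, hu, hv⟩ := hww'
    exact ⟨u, hu, v, hv, .inr huv⟩
  · rw [Set.disjoint_left]
    intro v hv hv'
    simp only [Set.mem_iUnion, Set.mem_ofPred_eq, exists_prop, exists_eq_right'] at hv hv'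
    exact Set.disjoint_left.1 (hBd i j hij) hv hv'
  · obtain ⟨x, hx, y, hy, -, u, v, huv, hu, hv⟩ := hBa i j hij
    exact ⟨u, Set.mem_biUnion hx hu, v, Set.mem_biUnion hy hv, huv⟩

/-- An edge inside one tree would close a short cycle. -/
lemma ctr_ne_of_not_tree (P : Voronoi G X r) (hg : ((8 * r + 2 : ℕ) : ℕ∞) < G.egirth) {u v : V}
    (huv : G.Adj u v) (ht : ¬ P.tree.Adj u v) : P.ctr u ≠ P.ctr v := by
  intro h
  obtain ⟨p, hp⟩ := P.exists_tree_walk u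
  obtain ⟨q, hq⟩ := P.exists_tree_walk v
  have := egirth_le_of_walk huv P.tree_le ht (p.append (q.reverse.copy h.symm rfl))
  refine absurd (hg.trans_le this) (not_lt.2 ?_)
  simp only [SimpleGraph.Walk.length_append, SimpleGraph.Walk.length_copy,
    SimpleGraph.Walk.length_reverse]
  exact_mod_cast (by omega : p.length + q.length + 1 ≤ 8 * r + 2)

/-- Two distinct edges between the same two trees would give a short cycle. -/
lemma eq_of_ctr_eq (P : Voronoi G X r) (hg : ((8 * r + 2 : ℕ) : ℕ∞) < G.egirth) {u v u' v' : V}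
    (huv : G.Adj u v) (ht : ¬ P.tree.Adj u v) (huv' : G.Adj u' v')
    (hu : P.ctr u = P.ctr u') (hv : P.ctr v = P.ctr v') : u = u' ∧ v = v' := by
  by_contra hne
  have hct := P.ctr_ne_of_not_tree hg huv ht
  let K := P.tree ⊔ SimpleGraph.edge u' v'
  have hK : K ≤ G := sup_le P.tree_le ((SimpleGraph.edge_le_iff G).2 (.inr huv'))
  have hKuv : ¬ K.Adj u v := by
    rw [SimpleGraph.sup_adj, SimpleGraph.edge_adj]
    rintro (h | ⟨⟨rfl, rfl⟩ | ⟨rfl, rfl⟩, -⟩)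
    · exact ht h
    · exact hne ⟨rfl, rfl⟩
    · exact hct hv.symm
  have hK' : K.Adj u' v' := by
    rw [SimpleGraph.sup_adj, SimpleGraph.edge_adj]
    exact .inr ⟨.inl ⟨rfl, rfl⟩, huv'.ne⟩
  have hle : P.tree ≤ K := le_sup_left
  obtain ⟨p, hp⟩ := P.exists_tree_walk u
  obtain ⟨p', hp'⟩ := P.exists_tree_walk u'
  obtain ⟨q, hq⟩ := P.exists_tree_walk v
  obtain ⟨q', hq'⟩ := P.exists_tree_walk v'
  have := egirth_le_of_walk huv hK hKuv
    (((p.append (p'.reverse.copy hu.symm rfl)).mapLe hle).append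
      (.cons hK' ((q'.append (q.reverse.copy hv rfl)).mapLe hle)))
  refine absurd (hg.trans_le this) (not_lt.2 ?_)
  simp only [SimpleGraph.Walk.length_append, SimpleGraph.Walk.length_copy,
    SimpleGraph.Walk.length_reverse, SimpleGraph.Walk.length_cons, SimpleGraph.Walk.length_map,
    SimpleGraph.Walk.mapLe]
  exact_mod_cast (by omega :
    p.length + p'.length + (q'.length + q.length + 1) + 1 ≤ 8 * r + 2)

/-- Contracting the trees loses only the tree edges. -/
lemma dartCount_le [Fintype V] (P : Voronoi G X r) (hg : ((8 * r + 2 : ℕ) : ℕ∞) < G.egirth) :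
    dartCount G Finset.univ + 2 * X.card ≤ dartCount P.contract X + 2 * Fintype.card V := by
  classical
  let E : Finset (V × V) := Finset.univ.filter fun q => G.Adj q.1 q.2
  have hE : dartCount G Finset.univ = E.card := by
    unfold dartCount
    rw [Finset.univ_product_univ]
  have h1 : (E.filter fun q => ¬ P.tree.Adj q.1 q.2).card ≤ dartCount P.contract X := by
    unfold dartCount
    refine Finset.card_le_card_of_injOn (fun q => (P.ctr q.1, P.ctr q.2)) ?_ ?_
    · rintro ⟨u, v⟩ h
      simp only [E, Finset.coe_filter, Finset.mem_filter, Finset.mem_univ, true_and,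
        Set.mem_ofPred_eq] at h
      simp only [Finset.coe_filter, Finset.mem_product, Set.mem_ofPred_eq]
      exact ⟨⟨P.ctr_mem u, P.ctr_mem v⟩, P.ctr_ne_of_not_tree hg h.1 h.2, u, v, h.1, rfl, rfl⟩
    · rintro ⟨u, v⟩ h ⟨u', v'⟩ h' heq
      simp only [E, Finset.coe_filter, Finset.mem_filter, Finset.mem_univ, true_and,
        Set.mem_ofPred_eq] at h h'
      simp only [Prod.mk.injEq] at heq ⊢
      exact P.eq_of_ctr_eq hg h.1 h.2 h'.1 heq.1 heq.2
  have h2 : (E.filter fun q => P.tree.Adj q.1 q.2).card ≤ Xᶜ.card + Xᶜ.card := by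
    calc _ ≤ (Xᶜ.image (fun v => (v, P.par v)) ∪ Xᶜ.image (fun v => (P.par v, v))).card := by
          refine Finset.card_le_card ?_
          rintro ⟨u, v⟩ h
          rcases P.tree_adj (Finset.mem_filter.1 h).2 with ⟨h1, h2⟩ | ⟨h1, h2⟩
          · exact Finset.mem_union_left _
              (Finset.mem_image.2 ⟨u, Finset.mem_compl.2 h1, by rw [← h2]⟩)
          · exact Finset.mem_union_right _
              (Finset.mem_image.2 ⟨v, Finset.mem_compl.2 h1, by rw [← h2]⟩)
      _ ≤ _ := (Finset.card_union_le _ _).trans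
          (add_le_add Finset.card_image_le Finset.card_image_le)
  have h3 := Finset.card_filter_add_card_filter_not (s := E) fun q : V × V => P.tree.Adj q.1 q.2
  have h4 := Finset.card_compl_add_card X
  omega

end Voronoi

/-- A maximal set of vertices at pairwise distances above `r` has distance at most `r` to every
vertex. -/
lemma exists_separated {V : Type*} [Finite V] (G : SimpleGraph V) (r : ℕ) :
    ∃ X : Finset V, (∀ x ∈ X, ∀ y ∈ X, ∀ p : G.Walk x y, p.length ≤ r → x = y) ∧
      ∀ v, ∃ x ∈ X, ∃ p : G.Walk v x, p.length ≤ r := by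
  classical
  have := Fintype.ofFinite V
  let S : Finset (Finset V) := Finset.univ.filter fun X =>
    ∀ x ∈ X, ∀ y ∈ X, ∀ p : G.Walk x y, p.length ≤ r → x = y
  obtain ⟨X, hX, hmax⟩ := S.exists_max_image Finset.card ⟨∅, by simp [S]⟩
  have hX' := (Finset.mem_filter.1 hX).2
  refine ⟨X, hX', fun v => ?_⟩
  by_contra! hv
  have hvX : v ∉ X := fun h => absurd (hv v h .nil) (by simp)
  have : insert v X ∈ S := by
    refine Finset.mem_filter.2 ⟨Finset.mem_univ _, fun x hx y hy p hp => ?_⟩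
    rcases Finset.mem_insert.1 hx with rfl | hxX
    · rcases Finset.mem_insert.1 hy with rfl | hyX
      · rfl
      · exact absurd (hv y hyX p) (by omega)
    · rcases Finset.mem_insert.1 hy with rfl | hyX
      · exact absurd (hv x hxX p.reverse) (by rw [SimpleGraph.Walk.length_reverse]; omega)
      · exact hX' x hxX y hyX p hp
  have := hmax _ this
  rw [Finset.card_insert_of_notMem hvX] at this
  omega

/-- A graph of large girth without a large complete minor has a reducible configuration. Otherwise,
contract trees around the vertices of a maximal separated set: as each tree contains many
vertices of degree at least three, the result is dense. -/
lemma isReducible_of_not_isMinor (t : ℕ) : ∃ g : ℕ, ∀ {V : Type*} [Finite V] [Nonempty V]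
    (G : SimpleGraph V), (g : ℕ∞) ≤ G.egirth → ¬ IsMinor (⊤ : SimpleGraph (Fin t)) G →
    IsReducible G := by
  classical
  -- Each tree will contain `D` vertices of degree at least three, which is the average degree that
  -- `hasFatModel_of_dense` asks for; the balls of radius `4 * D` around the centers lie in their
  -- trees, because the centers are more than `2 * (4 * D)` apart.
  let D := 4 * 2 ^ t
  let r := 2 * (4 * D + 10)
  refine ⟨8 * r + 3, fun {V} _ _ G hg hminor => ?_⟩
  by_contra hred
  have := Fintype.ofFinite V
  have hg' : ((8 * r + 2 : ℕ) : ℕ∞) < G.egirth :=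
    lt_of_lt_of_le (by exact_mod_cast (by omega : 8 * r + 2 < 8 * r + 3)) hg
  obtain ⟨X, hsep, hcov⟩ := exists_separated G r
  obtain ⟨P⟩ := exists_voronoi G X r hcov
  refine hminor (P.isMinor_of_hasFatModel (hasFatModel_of_dense t _ _ ?_))
  have hcount := P.dartCount_le hg'
  let deg : V → ℕ := fun v => (Finset.univ.filter fun w => G.Adj v w).card
  let B := Finset.univ.filter fun v => 3 ≤ deg v
  have hdeg : dartCount G Finset.univ = ∑ v, deg v := by
    unfold dartCount
    rw [Finset.univ_product_univ, ← Finset.univ_product_univ, Finset.card_filter,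
      Finset.sum_product]
    simp only [deg, Finset.card_filter]
  have hdeg2 : ∀ v, 2 ≤ deg v := by
    intro v
    by_contra! hv
    refine hred (.inl ⟨v, fun y z hy hz => ?_⟩)
    exact Finset.card_le_one.1 (Nat.le_of_lt_succ hv) y (by simpa using hy) z (by simpa using hz)
  have hsum : 2 * Fintype.card V + B.card ≤ dartCount G Finset.univ := by
    rw [hdeg, Finset.card_filter, mul_comm, ← smul_eq_mul, ← Finset.card_univ, ← Finset.sum_const,
      ← Finset.sum_add_distrib]
    refine Finset.sum_le_sum fun v _ => ?_
    have := hdeg2 v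
    split_ifs <;> omega
  have hB : D * X.card ≤ B.card := by
    rw [Finset.card_eq_sum_card_fiberwise (s := B) (f := P.ctr) (t := X)
      (fun v _ => P.ctr_mem v), mul_comm, ← smul_eq_mul, ← Finset.sum_const]
    refine Finset.sum_le_sum fun x hx => ?_
    obtain ⟨T, hT, hTv⟩ := exists_branching hred D
      (lt_of_le_of_lt (by exact_mod_cast (by omega : 4 * D + 10 ≤ 8 * r + 2)) hg') x
    rw [← hT]
    refine Finset.card_le_card fun v hv => ?_
    obtain ⟨⟨p, hp⟩, a, b, c, hab, hac, hbc, ha, hb, hc⟩ := hTv v hv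
    refine Finset.mem_filter.2 ⟨Finset.mem_filter.2 ⟨Finset.mem_univ _, ?_⟩, ?_⟩
    · exact Finset.two_lt_card.2 ⟨a, by simpa using ha, b, by simpa using hb, c, by simpa using hc,
        hab, hac, hbc⟩
    · obtain ⟨q, hq⟩ := P.ctr_near v
      have := hq x hx p.reverse
      rw [SimpleGraph.Walk.length_reverse] at this
      refine (hsep x hx _ (P.ctr_mem v) (p.append q) ?_).symm
      rw [SimpleGraph.Walk.length_append]
      omega
  have hX : 0 < X.card := by
    obtain ⟨v⟩ := ‹Nonempty V›
    exact Finset.card_pos.2 ⟨_, P.ctr_mem v⟩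
  change D * X.card < _
  omega

/-! ### Box representations through the endpoints of the intervals -/

/-- Intersections of boxes are decided by comparing endpoints in each coordinate. -/
lemma exists_isBoxRepresentation_iff {V : Type*} (G : SimpleGraph V) (d : ℕ) :
    (∃ B : V → Set (Fin d → ℝ), IsBoxRepresentation G B) ↔
      ∃ lo hi : V → Fin d → ℝ, (∀ v i, lo v i ≤ hi v i) ∧
        ∀ u v, u ≠ v → ((∀ i, lo u i ≤ hi v i ∧ lo v i ≤ hi u i) ↔ G.Adj u v) := by
  have key : ∀ a b a' b' : Fin d → ℝ, (∀ i, a i ≤ b i) → (∀ i, a' i ≤ b' i) →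
      (((Set.univ.pi fun i => Set.Icc (a i) (b i)) ∩
        Set.univ.pi fun i => Set.Icc (a' i) (b' i)).Nonempty ↔ ∀ i, a i ≤ b' i ∧ a' i ≤ b i) := by
    intro a b a' b' hab hab'
    constructor
    · rintro ⟨x, hx, hx'⟩ i
      have h := hx i trivial
      have h' := hx' i trivial
      exact ⟨h.1.trans h'.2, h'.1.trans h.2⟩
    · intro h
      exact ⟨fun i => max (a i) (a' i),
        fun i _ => ⟨le_max_left _ _, max_le (hab i) (h i).2⟩,
        fun i _ => ⟨le_max_right _ _, max_le (h i).1 (hab' i)⟩⟩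
  constructor
  · rintro ⟨B, hB, hadj⟩
    choose lo hi hle hBeq using hB
    refine ⟨lo, hi, hle, fun u v huv => ?_⟩
    rw [← hadj u v huv, hBeq u, hBeq v, key _ _ _ _ (hle u) (hle v)]
  · rintro ⟨lo, hi, hle, hadj⟩
    refine ⟨fun v => Set.univ.pi fun i => Set.Icc (lo v i) (hi v i),
      fun v => ⟨lo v, hi v, hle v, rfl⟩, fun u v huv => ?_⟩
    rw [key _ _ _ _ (hle u) (hle v), hadj u v huv]

/-! ### Building three-dimensional representations -/

/-- A box `[a₁, b₁] × [a₂, b₂] × [a₃, b₃]` with a point `(p₁, p₂)` in the interior of its footprint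
`[a₁, b₁] × [a₂, b₂]`. -/
structure PointedBox where
  (a₁ p₁ b₁ a₂ p₂ b₂ a₃ b₃ : ℝ)
  left₁ : a₁ < p₁
  right₁ : p₁ < b₁
  left₂ : a₂ < p₂
  right₂ : p₂ < b₂
  le₃ : a₃ ≤ b₃

namespace PointedBox

/-- The two boxes intersect. -/
def Meets (B C : PointedBox) : Prop :=
  ((B.a₁ ≤ C.b₁ ∧ C.a₁ ≤ B.b₁) ∧ B.a₂ ≤ C.b₂ ∧ C.a₂ ≤ B.b₂) ∧ B.a₃ ≤ C.b₃ ∧ C.a₃ ≤ B.b₃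

lemma meets_comm {B C : PointedBox} : B.Meets C ↔ C.Meets B := by
  unfold Meets; tauto

/-- The point of `C` lies in the footprint of `B`. -/
def Covers (B C : PointedBox) : Prop :=
  (B.a₁ ≤ C.p₁ ∧ C.p₁ ≤ B.b₁) ∧ B.a₂ ≤ C.p₂ ∧ C.p₂ ≤ B.b₂

end PointedBox

/-- The boxes `f v` represent the subgraph of `G` induced on `S`, and the vertical ray from the top
of every box at its point is free of the other boxes. -/
structure IsPointedRep {V : Type*} (G : SimpleGraph V) (S : Finset V) (f : V → PointedBox) :
    Prop where
  meets_iff : ∀ u ∈ S, ∀ v ∈ S, u ≠ v → ((f u).Meets (f v) ↔ G.Adj u v)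
  lt_of_covers : ∀ u ∈ S, ∀ v ∈ S, u ≠ v → (f u).Covers (f v) → (f u).b₃ < (f v).b₃

namespace IsPointedRep

variable {V : Type*} [DecidableEq V] {G : SimpleGraph V} {S : Finset V} {f : V → PointedBox}

lemma insert (hf : IsPointedRep G S f) {x : V} (hx : x ∉ S) (N : PointedBox)
    (h₁ : ∀ u ∈ S, (N.Meets (f u) ↔ G.Adj x u))
    (h₂ : ∀ u ∈ S, N.Covers (f u) → N.b₃ < (f u).b₃)
    (h₃ : ∀ u ∈ S, (f u).Covers N → (f u).b₃ < N.b₃) :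
    IsPointedRep G (insert x S) (Function.update f x N) := by
  have hne : ∀ u ∈ S, u ≠ x := fun u hu h => hx (h ▸ hu)
  constructor
  · intro u hu v hv huv
    rcases Finset.mem_insert.1 hu with rfl | huS <;> rcases Finset.mem_insert.1 hv with rfl | hvS
    · exact absurd rfl huv
    · simpa [hne v hvS] using h₁ v hvS
    · rw [PointedBox.meets_comm, G.adj_comm]
      simpa [hne u huS] using h₁ u huS
    · simpa [hne u huS, hne v hvS] using hf.meets_iff u huS v hvS huv
  · intro u hu v hv huv
    rcases Finset.mem_insert.1 hu with rfl | huS <;> rcases Finset.mem_insert.1 hv with rfl | hvS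
    · exact absurd rfl huv
    · simpa [hne v hvS] using h₂ v hvS
    · simpa [hne u huS] using h₃ u huS
    · simpa [hne u huS, hne v hvS] using hf.lt_of_covers u huS v hvS huv

/-- A vertex without neighbors gets a box far away from the others. -/
lemma exists_insert_isolated (hf : IsPointedRep G S f) {x : V} (hx : x ∉ S)
    (hadj : ∀ u ∈ S, ¬ G.Adj x u) : ∃ f', IsPointedRep G (Insert.insert x S) f' := by
  obtain ⟨M, hM⟩ := (S.image fun u => (f u).b₁).bddAbove
  have hM' : ∀ u ∈ S, (f u).b₁ ≤ M := fun u hu =>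
    hM (Finset.mem_coe.2 (Finset.mem_image_of_mem (fun u => (f u).b₁) hu))
  let N : PointedBox := ⟨M + 1, M + 2, M + 3, 0, 1, 2, 0, 0, by linarith, by linarith, by norm_num,
    by norm_num, le_rfl⟩
  refine ⟨_, hf.insert hx N (fun u hu => iff_of_false ?_ (hadj u hu)) ?_ ?_⟩
  · rintro ⟨⟨⟨h, -⟩, -⟩, -⟩
    have := hM' u hu
    simp only [N] at h
    linarith
  · rintro u hu ⟨⟨h, -⟩, -⟩
    have := hM' u hu
    have := (f u).right₁
    simp only [N] at h
    linarith
  · rintro u hu ⟨⟨-, h⟩, -⟩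
    have := hM' u hu
    simp only [N] at h
    linarith

/-- A vertex with a single neighbor `y` gets a thin column, of any sufficient height, standing on
the box of `y` next to the point of `y`. It is so close to that point that its two horizontal
intervals contain no coordinate of an old point, and miss every interval of an old box that does
not contain the coordinate of the point of `y`. -/
lemma exists_leaf (hf : IsPointedRep G S f) {x y : V} (hy : y ∈ S)
    (hadj : ∀ u ∈ S, (G.Adj x u ↔ u = y)) {t : ℝ} (ht : ∀ u ∈ S, (f u).b₃ < t) :
    ∃ N : PointedBox, N.a₃ = (f y).b₃ ∧ N.b₃ = t ∧
      (∀ u ∈ S, (N.Meets (f u) ↔ G.Adj x u)) ∧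
      (∀ u ∈ S, N.Covers (f u) → N.b₃ < (f u).b₃) ∧
      (∀ u ∈ S, (f u).Covers N → (f u).b₃ < N.b₃) ∧
      (∀ u ∈ S, ¬ (N.a₁ ≤ (f u).p₁ ∧ (f u).p₁ ≤ N.b₁)) ∧
      (∀ u ∈ S, ¬ (N.a₂ ≤ (f u).p₂ ∧ (f u).p₂ ≤ N.b₂)) ∧
      (∀ u ∈ S, ¬ ((f u).a₁ ≤ (f y).p₁ ∧ (f y).p₁ ≤ (f u).b₁) →
        ¬ (N.a₁ ≤ (f u).b₁ ∧ (f u).a₁ ≤ N.b₁)) ∧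
      (∀ u ∈ S, ¬ ((f u).a₂ ≤ (f y).p₂ ∧ (f y).p₂ ≤ (f u).b₂) →
        ¬ (N.a₂ ≤ (f u).b₂ ∧ (f u).a₂ ≤ N.b₂)) := by
  have hsmall : ∀ p q : ℝ, ∀ᶠ e in nhdsWithin (0 : ℝ) (Set.Ioi 0), p < q → p + 3 * e < q := by
    intro p q
    by_cases hpq : p < q
    · filter_upwards [Ioo_mem_nhdsGT (show (0 : ℝ) < (q - p) / 3 by linarith)] with e he _
      linarith [he.2]
    · exact Filter.Eventually.of_forall fun _ h => absurd h hpq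
  have hev : ∀ᶠ e in nhdsWithin (0 : ℝ) (Set.Ioi 0), 0 < e ∧ ∀ u ∈ S,
      ((f y).p₁ < (f u).a₁ → (f y).p₁ + 3 * e < (f u).a₁) ∧
      ((f y).p₁ < (f u).p₁ → (f y).p₁ + 3 * e < (f u).p₁) ∧
      ((f y).p₁ < (f u).b₁ → (f y).p₁ + 3 * e < (f u).b₁) ∧
      ((f y).p₂ < (f u).a₂ → (f y).p₂ + 3 * e < (f u).a₂) ∧
      ((f y).p₂ < (f u).p₂ → (f y).p₂ + 3 * e < (f u).p₂) ∧
      ((f y).p₂ < (f u).b₂ → (f y).p₂ + 3 * e < (f u).b₂) :=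
    Filter.Eventually.and self_mem_nhdsWithin <| (Filter.eventually_all_finset S).2 fun u _ =>
      (hsmall _ _).and <| (hsmall _ _).and <| (hsmall _ _).and <| (hsmall _ _).and <|
        (hsmall _ _).and (hsmall _ _)
  obtain ⟨e, he, hS⟩ := hev.exists
  let N : PointedBox := ⟨(f y).p₁ + e, (f y).p₁ + 2 * e, (f y).p₁ + 3 * e, (f y).p₂ + e,
    (f y).p₂ + 2 * e, (f y).p₂ + 3 * e, (f y).b₃, t, by linarith, by linarith, by linarith,
    by linarith, (ht y hy).le⟩
  refine ⟨N, rfl, rfl, fun u hu => ?_, fun u hu h => ?_, fun u hu _ => ht u hu, fun u hu h => ?_,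
    fun u hu h => ?_, fun u hu h h' => ?_, fun u hu h h' => ?_⟩
  · rw [hadj u hu]
    obtain ⟨h1, -, -, h4, -, -⟩ := hS u hu
    constructor
    · rintro ⟨⟨⟨h5, h6⟩, h7, h8⟩, h9, -⟩
      simp only [N] at h5 h6 h7 h8 h9
      by_contra hne
      have h10 := hf.lt_of_covers u hu y hy hne ⟨⟨?_, by linarith⟩, ?_, by linarith⟩
      · linarith
      · by_contra! h; linarith [h1 h]
      · by_contra! h; linarith [h4 h]
    · rintro rfl
      obtain ⟨-, -, h3, -, -, h6⟩ := hS u hu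
      have := h3 (f u).right₁
      have := h6 (f u).right₂
      have := (f u).left₁
      have := (f u).left₂
      have := (f u).le₃
      have := ht u hu
      refine ⟨⟨⟨?_, ?_⟩, ?_, ?_⟩, ?_, ?_⟩ <;> simp only [N] <;> linarith
  · have h1 : (f y).p₁ + e ≤ (f u).p₁ := h.1.1
    have h2 : (f u).p₁ ≤ (f y).p₁ + 3 * e := h.1.2
    linarith [(hS u hu).2.1 (by linarith)]
  · have h1 : (f y).p₁ + e ≤ (f u).p₁ := h.1
    have h2 : (f u).p₁ ≤ (f y).p₁ + 3 * e := h.2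
    linarith [(hS u hu).2.1 (by linarith)]
  · have h1 : (f y).p₂ + e ≤ (f u).p₂ := h.1
    have h2 : (f u).p₂ ≤ (f y).p₂ + 3 * e := h.2
    linarith [(hS u hu).2.2.2.2.1 (by linarith)]
  · have h1 : (f y).p₁ + e ≤ (f u).b₁ := h'.1
    have h2 : (f u).a₁ ≤ (f y).p₁ + 3 * e := h'.2
    refine h ⟨?_, by linarith⟩
    by_contra! h3
    linarith [(hS u hu).1 h3]
  · have h1 : (f y).p₂ + e ≤ (f u).b₂ := h'.1
    have h2 : (f u).a₂ ≤ (f y).p₂ + 3 * e := h'.2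
    refine h ⟨?_, by linarith⟩
    by_contra! h3
    linarith [(hS u hu).2.2.2.1 h3]

/-- Between points of two disjoint intervals there is a point outside both intervals. -/
lemma exists_between_intervals {a p b c q d : ℝ} (hap : a < p) (hpb : p < b) (hcq : c < q)
    (hqd : q < d) (h : ¬ (a ≤ d ∧ c ≤ b)) :
    ∃ m, min p q < m ∧ m < max p q ∧ ¬ (a ≤ m ∧ m ≤ b) ∧ ¬ (c ≤ m ∧ m ≤ d) := by
  rcases lt_or_ge b c with hbc | hbc
  · obtain ⟨m, h1, h2⟩ := exists_between hbc
    refine ⟨m, min_lt_of_left_lt (by linarith), lt_max_of_lt_right (by linarith), ?_, ?_⟩ <;>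
      rintro ⟨h3, h4⟩ <;> linarith
  · have hda : d < a := by
      by_contra! h'
      exact h ⟨h', hbc⟩
    obtain ⟨m, h1, h2⟩ := exists_between hda
    refine ⟨m, min_lt_of_right_lt (by linarith), lt_max_of_lt_left (by linarith), ?_, ?_⟩ <;>
      rintro ⟨h3, h4⟩ <;> linarith

/-- Two boxes that are higher than all others, and disjoint from each other in both horizontal
directions, can be joined by a path through two new vertices, represented by horizontal slabs at a
height `z` where there is nothing else. One slab runs from `P` in the first direction and the other
runs from `Q` in the second direction; they cross over the corner with the first coordinate of the
point of `Q` and the second coordinate of the point of `P`. -/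
lemma exists_bridge (hf : IsPointedRep G S f) {P Q s t : V} (hP : P ∈ S) (hQ : Q ∈ S)
    (hs : s ∉ S) (ht : t ∉ S) (hsP : ∀ u ∈ S, (G.Adj s u ↔ u = P))
    (htQ : ∀ u ∈ S, (G.Adj t u ↔ u = Q)) (hst : G.Adj s t) {z : ℝ}
    (hz : ∀ u ∈ S, u ≠ P → u ≠ Q → (f u).b₃ < z)
    (hzP : (f P).a₃ ≤ z ∧ z < (f P).b₃) (hzQ : (f Q).a₃ ≤ z ∧ z < (f Q).b₃)
    (h1 : ¬ ((f P).a₁ ≤ (f Q).b₁ ∧ (f Q).a₁ ≤ (f P).b₁))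
    (h2 : ¬ ((f P).a₂ ≤ (f Q).b₂ ∧ (f Q).a₂ ≤ (f P).b₂))
    (hP2 : ∀ u ∈ S, u ≠ P → (f u).p₂ ≠ (f P).p₂) (hQ1 : ∀ u ∈ S, u ≠ Q → (f u).p₁ ≠ (f Q).p₁) :
    ∃ f', IsPointedRep G (Insert.insert t (Insert.insert s S)) f' := by
  have hPl1 := (f P).left₁; have hPr1 := (f P).right₁
  have hPl2 := (f P).left₂; have hPr2 := (f P).right₂
  have hQl1 := (f Q).left₁; have hQr1 := (f Q).right₁
  have hQl2 := (f Q).left₂; have hQr2 := (f Q).right₂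
  -- The points of the slabs are chosen outside the footprints of the two high boxes.
  obtain ⟨m, hm1, hm2, hmP, hmQ⟩ := exists_between_intervals hPl1 hPr1 hQl1 hQr1 h1
  obtain ⟨n, hn1, hn2, hnP, hnQ⟩ := exists_between_intervals hPl2 hPr2 hQl2 hQr2 h2
  have hsmall : ∀ p q : ℝ, ∀ᶠ e in nhdsWithin (0 : ℝ) (Set.Ioi 0),
      (p < q → p + e < q) ∧ (q < p → q < p - e) := by
    intro p q
    rcases lt_trichotomy p q with hpq | hpq | hpq
    · filter_upwards [Ioo_mem_nhdsGT (show (0 : ℝ) < q - p by linarith)] with e he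
      exact ⟨fun _ => by linarith [he.2], fun h => by linarith⟩
    · exact Filter.Eventually.of_forall fun _ => ⟨fun h => by linarith, fun h => by linarith⟩
    · filter_upwards [Ioo_mem_nhdsGT (show (0 : ℝ) < p - q by linarith)] with e he
      exact ⟨fun h => by linarith, fun _ => by linarith [he.2]⟩
  have hev := (((Filter.eventually_all_finset S).2 fun u _ =>
    (hsmall (f P).p₂ (f u).p₂).and (hsmall (f Q).p₁ (f u).p₁)).and <|
    (hsmall (f P).p₂ (f Q).a₂).and <| (hsmall (f P).p₂ (f Q).b₂).and <|
    (hsmall (f Q).p₁ (f P).a₁).and <| (hsmall (f Q).p₁ (f P).b₁).and <|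
    (hsmall (f P).p₂ n).and <| (hsmall (f Q).p₁ m)).and
    (self_mem_nhdsWithin : Set.Ioi (0 : ℝ) ∈ nhdsWithin (0 : ℝ) (Set.Ioi 0))
  obtain ⟨e, ⟨heS, heQa, heQb, hePa, hePb, hen, hem⟩, he⟩ := hev.exists
  have hne_cases : ∀ {p q : ℝ}, ((p < q → p + e < q) ∧ (q < p → q < p - e)) → q ≠ p →
      ¬ (p - e ≤ q ∧ q ≤ p + e) := by
    rintro p q ⟨h3, h4⟩ hne ⟨h5, h6⟩
    rcases lt_or_gt_of_ne hne with h | h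
    · linarith [h4 h]
    · linarith [h3 h]
  let Ns : PointedBox := ⟨min (f P).p₁ (f Q).p₁, m, max (f P).p₁ (f Q).p₁, (f P).p₂ - e, (f P).p₂,
    (f P).p₂ + e, z, z, hm1, hm2, by linarith, by linarith, le_rfl⟩
  let Nt : PointedBox := ⟨(f Q).p₁ - e, (f Q).p₁, (f Q).p₁ + e, min (f P).p₂ (f Q).p₂, n,
    max (f P).p₂ (f Q).p₂, z, z, by linarith, by linarith, hn1, hn2, le_rfl⟩
  have hf' : IsPointedRep G (Insert.insert s S) (Function.update f s Ns) := by
    refine hf.insert hs Ns (fun u hu => ?_) (fun u hu h => ?_) (fun u hu h => ?_)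
    · rw [hsP u hu]
      constructor
      · rintro ⟨⟨-, h5, h6⟩, h7, -⟩
        simp only [Ns] at h5 h6 h7
        by_contra huP
        by_cases huQ : u = Q
        · subst huQ
          rcases lt_or_ge (f u).b₂ (f P).p₂ with h | h
          · linarith [heQb.2 h]
          · rcases lt_or_ge (f P).p₂ (f u).a₂ with h' | h'
            · linarith [heQa.1 h']
            · exact h2 ⟨by linarith, by linarith⟩
        · linarith [hz u hu huP huQ]
      · rintro rfl
        refine ⟨⟨⟨(min_le_left _ _).trans hPr1.le, hPl1.le.trans (le_max_left _ _)⟩, ?_, ?_⟩,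
          hzP.2.le, hzP.1⟩ <;> simp only [Ns] <;> linarith
    · by_cases huP : u = P
      · rw [huP]; exact hzP.2
      · exact absurd h.2 (hne_cases (heS u hu).1 (hP2 u hu huP))
    · by_cases huP : u = P
      · subst huP
        exact absurd h.1 hmP
      · by_cases huQ : u = Q
        · subst huQ
          have h3 := h.2.1
          have h4 := h.2.2
          simp only [Ns] at h3 h4
          exact absurd ⟨by linarith, by linarith⟩ h2
        · exact hz u hu huP huQ
  have hts : t ∉ Insert.insert s S := by
    rw [Finset.mem_insert, not_or]
    exact ⟨hst.ne', ht⟩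
  have hfs : ∀ u ∈ S, Function.update f s Ns u = f u := fun u hu =>
    Function.update_of_ne (fun h : u = s => hs (h ▸ hu)) _ _
  refine ⟨_, hf'.insert hts Nt (fun u hu => ?_) (fun u hu h => ?_) (fun u hu h => ?_)⟩
  · rcases Finset.mem_insert.1 hu with rfl | huS
    · rw [Function.update_self]
      refine iff_of_true ?_ hst.symm
      refine ⟨⟨⟨?_, ?_⟩, ?_, ?_⟩, le_rfl, le_rfl⟩ <;> simp only [Ns, Nt]
      · linarith [le_max_right (f P).p₁ (f Q).p₁]
      · linarith [min_le_right (f P).p₁ (f Q).p₁]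
      · linarith [min_le_left (f P).p₂ (f Q).p₂]
      · linarith [le_max_left (f P).p₂ (f Q).p₂]
    rw [hfs u huS, htQ u huS]
    constructor
    · rintro ⟨⟨⟨h5, h6⟩, -⟩, h7, -⟩
      simp only [Nt] at h5 h6 h7
      by_contra huQ
      by_cases huP : u = P
      · subst huP
        rcases lt_or_ge (f u).b₁ (f Q).p₁ with h | h
        · linarith [hePb.2 h]
        · rcases lt_or_ge (f Q).p₁ (f u).a₁ with h' | h'
          · linarith [hePa.1 h']
          · exact h1 ⟨by linarith, by linarith⟩
      · linarith [hz u huS huP huQ]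
    · rintro rfl
      refine ⟨⟨⟨?_, ?_⟩, (min_le_right _ _).trans hQr2.le, hQl2.le.trans (le_max_right _ _)⟩,
        hzQ.2.le, hzQ.1⟩ <;> simp only [Nt] <;> linarith
  · rcases Finset.mem_insert.1 hu with rfl | huS
    · rw [Function.update_self] at h
      refine absurd h.1 (hne_cases hem fun h3 => hmQ ?_)
      rw [show m = (f Q).p₁ from h3]
      exact ⟨hQl1.le, hQr1.le⟩
    rw [hfs u huS] at h ⊢
    by_cases huQ : u = Q
    · rw [huQ]; exact hzQ.2
    · exact absurd h.1 (hne_cases (heS u huS).2 (hQ1 u huS huQ))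
  · rcases Finset.mem_insert.1 hu with rfl | huS
    · rw [Function.update_self] at h
      refine absurd h.2 (hne_cases hen fun h3 => hnP ?_)
      rw [show n = (f P).p₂ from h3]
      exact ⟨hPl2.le, hPr2.le⟩
    rw [hfs u huS] at h ⊢
    by_cases huQ : u = Q
    · subst huQ
      exact absurd h.2 hnQ
    · by_cases huP : u = P
      · subst huP
        have h3 := h.1.1
        have h4 := h.1.2
        simp only [Nt] at h3 h4
        exact absurd ⟨by linarith, by linarith⟩ h1
      · exact hz u huS huP huQ

/-- A new path `a, P, s, t, Q, b` between two old vertices `a` and `b`: columns for `P` and `Q` on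
the boxes of `a` and `b`, joined above all other boxes. The column of `Q` is inserted after that of
`P` and therefore avoids it in both horizontal directions. -/
lemma exists_insert_path (hf : IsPointedRep G S f) {a b P Q s t : V} (ha : a ∈ S) (hb : b ∈ S)
    (hP : P ∉ S) (hQ : Q ∉ S) (hs : s ∉ S) (ht : t ∉ S) (hPQ : P ≠ Q)
    (hPs : G.Adj P s) (hst : G.Adj s t) (htQ : G.Adj t Q) (nPt : ¬ G.Adj P t) (nPQ : ¬ G.Adj P Q)
    (nsQ : ¬ G.Adj s Q) (hPa : ∀ u ∈ S, (G.Adj P u ↔ u = a)) (hQb : ∀ u ∈ S, (G.Adj Q u ↔ u = b))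
    (hsS : ∀ u ∈ S, ¬ G.Adj s u) (htS : ∀ u ∈ S, ¬ G.Adj t u) :
    ∃ f', IsPointedRep G (Insert.insert t (Insert.insert s (Insert.insert Q (Insert.insert P S))))
      f' := by
  obtain ⟨z, hz⟩ : ∃ z, ∀ u ∈ S, (f u).b₃ < z := by
    obtain ⟨M, hM⟩ := (S.image fun u => (f u).b₃).bddAbove
    refine ⟨M + 1, fun u hu => ?_⟩
    have := hM (Finset.mem_coe.2 (Finset.mem_image_of_mem (fun u => (f u).b₃) hu))
    linarith
  obtain ⟨N, hN3, hNt, hN1, hN2, hN4, hNx, hNy, -, -⟩ := hf.exists_leaf ha hPa (t := z + 1)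
    fun u hu => by linarith [hz u hu]
  have hf₁ := hf.insert hP N hN1 hN2 hN4
  have hf₁S : ∀ u ∈ S, Function.update f P N u = f u := fun u hu =>
    Function.update_of_ne (fun h : u = P => hP (h ▸ hu)) _ _
  have hf₁P : Function.update f P N P = N := Function.update_self _ _ _
  generalize Function.update f P N = f₁ at hf₁ hf₁S hf₁P
  have hbP : b ≠ P := fun h => hP (h ▸ hb)
  have hbS₁ : b ∈ Insert.insert P S := Finset.mem_insert_of_mem hb
  have hPS₁ : P ∈ Insert.insert P S := Finset.mem_insert_self _ _
  obtain ⟨M, hM3, hMt, hM1, hM2, hM4, hMx, hMy, hMx', hMy'⟩ :=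
    hf₁.exists_leaf (x := Q) (y := b) (t := z + 2) hbS₁
      (fun u hu => by
        rcases Finset.mem_insert.1 hu with rfl | hu
        · exact iff_of_false (fun h => nPQ h.symm) hbP.symm
        · exact hQb u hu)
      (fun u hu => by
        rcases Finset.mem_insert.1 hu with rfl | hu
        · rw [hf₁P]; linarith
        · rw [hf₁S u hu]; linarith [hz u hu])
  have hQS₁ : Q ∉ Insert.insert P S := by
    rw [Finset.mem_insert, not_or]
    exact ⟨hPQ.symm, hQ⟩
  have hf₂ := hf₁.insert hQS₁ M hM1 hM2 hM4
  have hf₂S : ∀ u ∈ Insert.insert P S, Function.update f₁ Q M u = f₁ u := fun u hu =>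
    Function.update_of_ne (fun h : u = Q => hQS₁ (h ▸ hu)) _ _
  have hf₂Q : Function.update f₁ Q M Q = M := Function.update_self _ _ _
  generalize Function.update f₁ Q M = f₂ at hf₂ hf₂S hf₂Q
  have hf₂P : f₂ P = N := (hf₂S P hPS₁).trans hf₁P
  have hMP := hMx' P hPS₁
  have hMP' := hMy' P hPS₁
  rw [hf₁P, hf₁S b hb] at hMP hMP'
  refine hf₂.exists_bridge (P := P) (Q := Q) (z := z) (Finset.mem_insert_of_mem hPS₁)
    (Finset.mem_insert_self _ _) ?_ ?_ ?_ ?_ hst ?_ ?_ ?_ ?_ ?_ ?_ ?_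
  · simp only [Finset.mem_insert, not_or]
    exact ⟨fun h => nPQ (h ▸ hPs), hPs.ne', hs⟩
  · simp only [Finset.mem_insert, not_or]
    exact ⟨htQ.ne, fun h => nPQ (h ▸ htQ), ht⟩
  · intro u hu
    rcases Finset.mem_insert.1 hu with rfl | hu
    · exact iff_of_false nsQ hPQ.symm
    · rcases Finset.mem_insert.1 hu with rfl | hu
      · exact iff_of_true hPs.symm rfl
      · exact iff_of_false (hsS u hu) fun h => hP (h ▸ hu)
  · intro u hu
    rcases Finset.mem_insert.1 hu with rfl | hu
    · exact iff_of_true htQ rfl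
    · rcases Finset.mem_insert.1 hu with rfl | hu
      · exact iff_of_false (fun h => nPt h.symm) hPQ
      · exact iff_of_false (htS u hu) fun h => hQ (h ▸ hu)
  · intro u hu huP huQ
    rcases Finset.mem_insert.1 hu with rfl | hu
    · exact absurd rfl huQ
    · rcases Finset.mem_insert.1 hu with rfl | huS
      · exact absurd rfl huP
      · rw [hf₂S u hu, hf₁S u huS]
        exact hz u huS
  · rw [hf₂P, hN3, hNt]
    exact ⟨(hz a ha).le, by linarith⟩
  · rw [hf₂Q, hM3, hMt, hf₁S b hb]
    exact ⟨(hz b hb).le, by linarith⟩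
  · rw [hf₂P, hf₂Q]
    exact fun h => hMP (hNx b hb) h.symm
  · rw [hf₂P, hf₂Q]
    exact fun h => hMP' (hNy b hb) h.symm
  · intro u hu huP h
    rw [hf₂P] at h
    rcases Finset.mem_insert.1 hu with rfl | hu
    · have h' := hMy P hPS₁
      rw [hf₁P, ← h, hf₂Q] at h'
      exact h' ⟨M.left₂.le, M.right₂.le⟩
    · rcases Finset.mem_insert.1 hu with rfl | huS
      · exact absurd rfl huP
      · have h' := hNy u huS
        rw [← hf₁S u huS, ← hf₂S u hu, h] at h'
        exact h' ⟨N.left₂.le, N.right₂.le⟩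
  · intro u hu huQ h
    rw [hf₂Q] at h
    rcases Finset.mem_insert.1 hu with rfl | hu
    · exact absurd rfl huQ
    · have h' := hMx u hu
      rw [← hf₂S u hu, h] at h'
      exact h' ⟨M.left₁.le, M.right₁.le⟩

end IsPointedRep

/-- Remove a leaf, or the four inner vertices of a path of the reducible configuration, and insert
them into a representation of the rest. -/
lemma exists_isPointedRep {V : Type*} {G : SimpleGraph V}
    (hG : ∀ S : Finset V, S.Nonempty → IsReducible (G.induce (S : Set V))) (S : Finset V) :
    ∃ f, IsPointedRep G S f := by
  classical
  induction S using Finset.strongInduction with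
  | H S ih =>
  rcases S.eq_empty_or_nonempty with rfl | hS
  · exact ⟨fun _ => ⟨0, 1, 2, 0, 1, 2, 0, 0, by norm_num, by norm_num, by norm_num, by norm_num,
      le_rfl⟩, by simp, by simp⟩
  rcases hG S hS with ⟨⟨v, hvS⟩, hv⟩ | ⟨s, hinj, hadj, hdeg⟩
  · have hvS' : v ∈ S := hvS
    obtain ⟨f, hf⟩ := ih (S.erase v) (Finset.erase_ssubset hvS')
    by_cases hy : ∃ y ∈ S.erase v, G.Adj v y
    · obtain ⟨y, hyS, hvy⟩ := hy
      obtain ⟨M, hM⟩ := ((S.erase v).image fun u => (f u).b₃).bddAbove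
      obtain ⟨N, -, -, h1, h2, h3, -⟩ := hf.exists_leaf (x := v) (y := y) (t := M + 1) hyS
        (fun u hu => ⟨fun h => by
          have := hv ⟨u, Finset.mem_of_mem_erase hu⟩ ⟨y, Finset.mem_of_mem_erase hyS⟩ h hvy
          exact congrArg Subtype.val this, fun h => h ▸ hvy⟩)
        (fun u hu => by
          have := hM (Finset.mem_coe.2 (Finset.mem_image_of_mem (fun u => (f u).b₃) hu))
          linarith)
      have := hf.insert (Finset.notMem_erase v S) N h1 h2 h3
      rw [Finset.insert_erase hvS'] at this
      exact ⟨_, this⟩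
    · push Not at hy
      have := hf.exists_insert_isolated (Finset.notMem_erase v S) hy
      rwa [Finset.insert_erase hvS'] at this
  · have hne : ∀ i j, i ≤ 5 → j ≤ 5 → i ≠ j → (s i : V) ≠ s j := fun i j hi hj hij h =>
      hij (hinj ⟨Nat.zero_le _, hi⟩ ⟨Nat.zero_le _, hj⟩ (Subtype.ext h))
    let S' := S \ {(s 1 : V), (s 2 : V), (s 3 : V), (s 4 : V)}
    have hmem : ∀ i, (s i : V) ∈ S := fun i => (s i).2
    have hS' : ∀ u, u ∈ S' ↔ u ∈ S ∧ u ≠ s 1 ∧ u ≠ s 2 ∧ u ≠ s 3 ∧ u ≠ s 4 := by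
      intro u
      simp [S']
    have hnbr : ∀ i, 1 ≤ i → i ≤ 4 → ∀ u ∈ S, G.Adj (s i) u → u = s (i - 1) ∨ u = s (i + 1) := by
      intro i h1 h4 u hu h
      rcases hdeg i ⟨h1, h4⟩ ⟨u, hu⟩ h with h | h
      · exact .inl (congrArg Subtype.val h)
      · exact .inr (congrArg Subtype.val h)
    have hadj' : ∀ i, G.Adj (s i) (s (i + 1)) := fun i => hadj i
    have hnadj : ∀ i j, 1 ≤ i → i ≤ 4 → j ≤ 5 → j ≠ i - 1 → j ≠ i + 1 →
        ¬ G.Adj (s i : V) (s j) := by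
      intro i j h1 h4 h5 hj hj' h
      rcases hnbr i h1 h4 _ (hmem j) h with h | h
      · exact hne j (i - 1) h5 (by omega) hj h
      · exact hne j (i + 1) h5 (by omega) hj' h
    obtain ⟨f, hf⟩ := ih S' (Finset.sdiff_ssubset (by
      intro u hu
      simp only [Finset.mem_insert, Finset.mem_singleton] at hu
      rcases hu with rfl | rfl | rfl | rfl <;> exact hmem _) ⟨s 1, by simp⟩)
    have hout : ∀ i, 1 ≤ i → i ≤ 4 → (s i : V) ∉ S' := by
      intro i h1 h4 h
      obtain ⟨-, h5, h6, h7, h8⟩ := (hS' _).1 h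
      interval_cases i <;> contradiction
    have h0 : (s 0 : V) ∈ S' := (hS' _).2 ⟨hmem 0, hne 0 1 (by omega) (by omega) (by omega),
      hne 0 2 (by omega) (by omega) (by omega), hne 0 3 (by omega) (by omega) (by omega),
      hne 0 4 (by omega) (by omega) (by omega)⟩
    have h5 : (s 5 : V) ∈ S' := (hS' _).2 ⟨hmem 5, hne 5 1 (by omega) (by omega) (by omega),
      hne 5 2 (by omega) (by omega) (by omega), hne 5 3 (by omega) (by omega) (by omega),
      hne 5 4 (by omega) (by omega) (by omega)⟩
    have := hf.exists_insert_path (a := s 0) (b := s 5) (P := s 1) (Q := s 4) (s := s 2) (t := s 3)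
      h0 h5 (hout 1 (by omega) (by omega)) (hout 4 (by omega) (by omega))
      (hout 2 (by omega) (by omega)) (hout 3 (by omega) (by omega))
      (hne 1 4 (by omega) (by omega) (by omega)) (hadj' 1) (hadj' 2) (hadj' 3)
      (hnadj 1 3 (by omega) (by omega) (by omega) (by omega) (by omega))
      (hnadj 1 4 (by omega) (by omega) (by omega) (by omega) (by omega))
      (hnadj 2 4 (by omega) (by omega) (by omega) (by omega) (by omega))
      (fun u hu => by
        obtain ⟨h6, h7, h8, h9, h10⟩ := (hS' u).1 hu
        refine ⟨fun h => ?_, fun h => h ▸ (hadj' 0).symm⟩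
        rcases hnbr 1 (by omega) (by omega) u h6 h with h | h
        · exact h
        · exact absurd h h8)
      (fun u hu => by
        obtain ⟨h6, h7, h8, h9, h10⟩ := (hS' u).1 hu
        refine ⟨fun h => ?_, fun h => h ▸ hadj' 4⟩
        rcases hnbr 4 (by omega) (by omega) u h6 h with h | h
        · exact absurd h h9
        · exact h)
      (fun u hu h => by
        obtain ⟨h6, h7, h8, h9, h10⟩ := (hS' u).1 hu
        rcases hnbr 2 (by omega) (by omega) u h6 h with h | h
        · exact h7 h
        · exact h9 h)
      (fun u hu h => by
        obtain ⟨h6, h7, h8, h9, h10⟩ := (hS' u).1 hu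
        rcases hnbr 3 (by omega) (by omega) u h6 h with h | h
        · exact h8 h
        · exact h10 h)
    have hins : insert (s 3 : V) (insert (s 2 : V) (insert (s 4 : V) (insert (s 1 : V) S'))) = S := by
      ext u
      simp only [Finset.mem_insert, hS']
      constructor
      · rintro (rfl | rfl | rfl | rfl | h)
        · exact hmem 3
        · exact hmem 2
        · exact hmem 4
        · exact hmem 1
        · exact h.1
      · tauto
    rwa [hins] at this

lemma IsPointedRep.boxicity_le {V : Type*} [Fintype V] {G : SimpleGraph V} {f : V → PointedBox}
    (hf : IsPointedRep G Finset.univ f) : boxicity G ≤ 3 := by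
  refine iInf₂_le_of_le 3 ⟨by norm_num, ?_⟩ le_rfl
  rw [exists_isBoxRepresentation_iff]
  refine ⟨fun v => ![(f v).a₁, (f v).a₂, (f v).a₃], fun v => ![(f v).b₁, (f v).b₂, (f v).b₃],
    fun v i => ?_, fun u v huv => ?_⟩
  · fin_cases i
    · exact ((f v).left₁.trans (f v).right₁).le
    · exact ((f v).left₂.trans (f v).right₂).le
    · exact (f v).le₃
  · rw [← hf.meets_iff u (Finset.mem_univ _) v (Finset.mem_univ _) huv]
    simp [Fin.forall_fin_succ, PointedBox.Meets, and_assoc]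

/-- Graphs of large girth without a large complete minor have boxicity at most three. -/
lemma exists_boxicity_le_three (t : ℕ) : ∃ g : ℕ, ∀ {V : Type*} [Finite V] (G : SimpleGraph V),
    (g : ℕ∞) ≤ G.egirth → ¬ IsMinor (⊤ : SimpleGraph (Fin t)) G → boxicity G ≤ 3 := by
  obtain ⟨g, hg⟩ := isReducible_of_not_isMinor t
  refine ⟨g, fun {V} _ G hG hminor => ?_⟩
  have := Fintype.ofFinite V
  obtain ⟨f, hf⟩ := exists_isPointedRep (G := G) (fun S hS => by
    have : Nonempty (S : Set V) := hS.to_subtype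
    refine hg _ (hG.trans (egirth_induce_le G _)) fun h => hminor (h.trans ?_)
    exact .of_hom Subtype.val Subtype.val_injective fun _ _ h => h) Finset.univ
  exact hf.boxicity_le

lemma exists_girth_of_minorClosed {F : GraphClass.{u}} (hF : F.IsMinorClosed) (hp : F.IsProper) :
    ∃ g : ℕ, ∀ (V : Type u) [Finite V] (G : SimpleGraph V), F V G → (g : ℕ∞) ≤ G.egirth →
      boxicity G ≤ 3 := by
  obtain ⟨W, _, H, hH⟩ := hp
  obtain ⟨g, hg⟩ := exists_boxicity_le_three (Nat.card W)
  refine ⟨g, fun V _ G hG hgG => hg G hgG fun hminor => hH ?_⟩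
  refine hF V W G H hG (IsMinor.trans ?_ hminor)
  let e := Finite.equivFin W
  exact .of_hom e e.injective fun w w' h => e.injective.ne h.ne

/-! ### Sums along walks -/

/-- The sum of `f` over the steps of a walk, modulo two. -/
def walkSum {V : Type*} {G : SimpleGraph V} (f : V → V → ZMod 2) :
    ∀ {u v : V}, G.Walk u v → ZMod 2
  | _, _, .nil => 0
  | u, _, .cons (v := w) _ p => f u w + walkSum f p

section walkSum

variable {V : Type*} {G : SimpleGraph V} {f g : V → V → ZMod 2}

lemma walkSum_append {u v w : V} (p : G.Walk u v) (q : G.Walk v w) :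
    walkSum f (p.append q) = walkSum f p + walkSum f q := by
  induction p with
  | nil => simp [walkSum]
  | cons h p ih => simp [walkSum, ih, add_assoc]

lemma walkSum_reverse (hf : ∀ u v, f u v = f v u) {u v : V} (p : G.Walk u v) :
    walkSum f p.reverse = walkSum f p := by
  induction p with
  | nil => simp [walkSum]
  | cons h p ih =>
    rw [SimpleGraph.Walk.reverse_cons, walkSum_append, ih]
    simp [walkSum, hf, add_comm]

lemma walkSum_add {u v : V} (p : G.Walk u v) :
    walkSum (fun x y => f x y + g x y) p = walkSum f p + walkSum g p := by
  induction p with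
  | nil => simp [walkSum]
  | cons _ p ih => simp only [walkSum, ih]; ring

lemma walkSum_congr {u v : V} (p : G.Walk u v)
    (h : ∀ x ∈ p.support, ∀ y ∈ p.support, G.Adj x y → f x y = g x y) :
    walkSum f p = walkSum g p := by
  induction p with
  | nil => rfl
  | cons hadj p ih =>
    simp only [walkSum]
    rw [h _ (by simp) _ (by simp) hadj,
      ih fun x hx y hy => h x (by simp [hx]) y (by simp [hy])]

lemma walkSum_zero {u v : V} (p : G.Walk u v) : walkSum (fun _ _ => 0) p = 0 := by
  induction p with
  | nil => rfl
  | cons h p ih => simp [walkSum, ih]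

lemma walkSum_telescope (φ : V → ZMod 2) {u v : V} (p : G.Walk u v) :
    walkSum (fun x y => φ x + φ y) p = φ u + φ v := by
  induction p with
  | nil => simp [walkSum, CharTwo.add_self_eq_zero]
  | @cons a b c h p ih =>
    simp only [walkSum, ih]
    linear_combination CharTwo.add_self_eq_zero (φ b)

lemma walkSum_comm (k : V → V → V → V → ZMod 2) {u v u' v' : V} (p : G.Walk u v)
    (q : G.Walk u' v') :
    walkSum (fun x y => walkSum (k x y) q) p =
      walkSum (fun x' y' => walkSum (fun x y => k x y x' y') p) q := by
  induction p with
  | nil => simp [walkSum, walkSum_zero]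
  | cons h p ih => simp only [walkSum, walkSum_add, ih]

end walkSum

/-! ### Crossings of walks in the square grid -/

/-- The infinite square grid. -/
def grid : SimpleGraph (ℤ × ℤ) where
  Adj u v := (u.1 = v.1 ∧ (v.2 = u.2 + 1 ∨ u.2 = v.2 + 1)) ∨
    (u.2 = v.2 ∧ (v.1 = u.1 + 1 ∨ u.1 = v.1 + 1))
  symm := ⟨fun _ _ _ => by omega⟩
  loopless := ⟨fun _ _ => by omega⟩

/-- Whether the edge `uv` of the grid crosses the edge `u'v'` shifted by `(1/2, 1/2)`. -/
def cross (u v u' v' : ℤ × ℤ) : ZMod 2 :=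
  if (u.1 = v.1 ∧ u'.2 = v'.2 ∧ min u'.1 v'.1 = u.1 - 1 ∧ u'.2 = min u.2 v.2) ∨
    (u.2 = v.2 ∧ u'.1 = v'.1 ∧ u'.1 = min u.1 v.1 ∧ min u'.2 v'.2 = u.2 - 1) then 1 else 0

/-- Whether the edge `uv` of the grid crosses the horizontal ray to the right of
`x + (1/2, 1/2)`. -/
def rayCross (u v x : ℤ × ℤ) : ZMod 2 :=
  if u.1 = v.1 ∧ x.1 < u.1 ∧ min u.2 v.2 = x.2 then 1 else 0

/-- The parity of the number of crossings of `p` with the shift of `q` by `(1/2, 1/2)`. -/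
def crossings {u v u' v' : ℤ × ℤ} (p : grid.Walk u v) (q : grid.Walk u' v') : ZMod 2 :=
  walkSum (fun x y => walkSum (cross x y) q) p

lemma cross_symm_left (u v u' v' : ℤ × ℤ) : cross u v u' v' = cross v u u' v' := by
  unfold cross
  refine if_congr ?_ rfl rfl
  omega

lemma cross_symm_right (u v u' v' : ℤ × ℤ) : cross u v u' v' = cross u v v' u' := by
  unfold cross
  refine if_congr ?_ rfl rfl
  omega

lemma cross_eq_zero {u v u' v' : ℤ × ℤ} (h' : grid.Adj u' v')
    (h1 : u ≠ u') (h2 : u ≠ v') (h3 : v ≠ u') (h4 : v ≠ v') : cross u v u' v' = 0 := by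
  unfold cross
  refine if_neg ?_
  simp only [ne_eq, Prod.ext_iff] at h1 h2 h3 h4
  simp only [grid] at h'
  omega

/-- Moving a point across an edge changes the number of crossings of its ray with another edge
`uv` by the crossing of the two edges, up to a term that cancels along closed walks. -/
lemma cross_add_rayCross {u v u' v' : ℤ × ℤ} (h : grid.Adj u v) (h' : grid.Adj u' v') :
    cross u v u' v' + (rayCross u v u' + rayCross u v v') =
      (if u'.1 = v'.1 ∧ u'.1 < u.1 ∧ u.2 = max u'.2 v'.2 then 1 else 0) +
        (if u'.1 = v'.1 ∧ u'.1 < v.1 ∧ v.2 = max u'.2 v'.2 then 1 else 0) := by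
  simp only [grid] at h h'
  unfold cross rayCross
  rcases h' with ⟨h1, h2⟩ | ⟨h1, h2⟩
  · rcases h with ⟨h3, h4⟩ | ⟨h3, h4⟩
    · have hc : ¬ ((u.1 = v.1 ∧ u'.2 = v'.2 ∧ min u'.1 v'.1 = u.1 - 1 ∧ u'.2 = min u.2 v.2) ∨
        (u.2 = v.2 ∧ u'.1 = v'.1 ∧ u'.1 = min u.1 v.1 ∧ min u'.2 v'.2 = u.2 - 1)) := by omega
      rw [if_neg hc]
      split_ifs <;> first | rfl | (exfalso; omega)
    · have hr : ∀ x : ℤ × ℤ, ¬ (u.1 = v.1 ∧ x.1 < u.1 ∧ min u.2 v.2 = x.2) := fun x => by omega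
      rw [if_neg (hr _), if_neg (hr _)]
      split_ifs <;> first | rfl | (exfalso; omega)
  · have hz : ∀ w : ℤ × ℤ, ¬ (u'.1 = v'.1 ∧ u'.1 < w.1 ∧ w.2 = max u'.2 v'.2) :=
      fun w => by omega
    rw [if_neg (hz _), if_neg (hz _)]
    split_ifs <;> first | rfl | (exfalso; omega)

section crossings

variable {u v w u' v' w' : ℤ × ℤ}

lemma crossings_append_left (p : grid.Walk u v) (p' : grid.Walk v w) (q : grid.Walk u' v') :
    crossings (p.append p') q = crossings p q + crossings p' q :=
  walkSum_append _ _

lemma crossings_append_right (p : grid.Walk u v) (q : grid.Walk u' v') (q' : grid.Walk v' w') :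
    crossings p (q.append q') = crossings p q + crossings p q' := by
  unfold crossings
  simp only [walkSum_append, walkSum_add]

lemma crossings_reverse_left (p : grid.Walk u v) (q : grid.Walk u' v') :
    crossings p.reverse q = crossings p q := by
  unfold crossings
  refine walkSum_reverse (fun x y => ?_) p
  congr 1
  funext x' y'
  exact cross_symm_left _ _ _ _

lemma crossings_reverse_right (p : grid.Walk u v) (q : grid.Walk u' v') :
    crossings p q.reverse = crossings p q := by
  unfold crossings
  congr 1
  funext x y
  exact walkSum_reverse (cross_symm_right x y) q

/-- Two closed walks cross an even number of times. -/
lemma crossings_closed (p : grid.Walk u u) (q : grid.Walk v v) : crossings p q = 0 := by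
  unfold crossings
  rw [walkSum_comm]
  let W : ℤ × ℤ → ZMod 2 := fun x => walkSum (fun a b => rayCross a b x) p
  have key : ∀ x y, grid.Adj x y → walkSum (fun a b => cross a b x y) p = W x + W y := by
    intro x y hxy
    have h1 : walkSum (fun a b => cross a b x y + (rayCross a b x + rayCross a b y)) p = 0 := by
      rw [walkSum_congr p fun a _ b _ hab => cross_add_rayCross hab hxy,
        walkSum_telescope (fun a : ℤ × ℤ => if x.1 = y.1 ∧ x.1 < a.1 ∧ a.2 = max x.2 y.2 then 1 else 0),
        CharTwo.add_self_eq_zero]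
    rw [walkSum_add, walkSum_add] at h1
    exact CharTwo.add_eq_zero.1 h1
  rw [walkSum_congr q fun x _ y _ hxy => key x y hxy, walkSum_telescope,
    CharTwo.add_self_eq_zero]

/-- The parity of the crossings with a closed walk depends only on the ends of the other walk. -/
lemma crossings_add_eq (p p' : grid.Walk u v) (q q' : grid.Walk u' v') :
    crossings p q + crossings p' q = crossings p q' + crossings p' q' := by
  have := crossings_closed (p.append p'.reverse) (q.append q'.reverse)
  rw [crossings_append_left, crossings_reverse_left, crossings_append_right,
    crossings_append_right, crossings_reverse_right, crossings_reverse_right] at this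
  refine CharTwo.add_eq_zero.1 ?_
  rw [← this]
  ring

lemma crossings_eq_zero (p : grid.Walk u v) (q : grid.Walk u' v')
    (h : ∀ x ∈ p.support, x ∉ q.support) : crossings p q = 0 := by
  unfold crossings
  rw [walkSum_congr p (g := fun _ _ => 0), walkSum_zero]
  intro x hx y hy hxy
  rw [walkSum_congr q (g := fun _ _ => 0), walkSum_zero]
  intro x' hx' y' hy' hxy'
  exact cross_eq_zero hxy' (fun e => h x hx (e ▸ hx')) (fun e => h x hx (e ▸ hy'))
    (fun e => h y hy (e ▸ hx')) fun e => h y hy (e ▸ hy')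

/-- Two walks that share only their first vertex cross only in their first edges. -/
lemma crossings_cons_cons {a : ℤ × ℤ} (h : grid.Adj a u) (p : grid.Walk u v)
    (h' : grid.Adj a u') (q : grid.Walk u' v') (hp : a ∉ p.support) (hq : a ∉ q.support)
    (hpq : ∀ x ∈ p.support, x ∉ q.support) :
    crossings (.cons h p) (.cons h' q) = cross a u a u' := by
  have hu : u ∈ p.support := p.start_mem_support
  have hu' : u' ∈ q.support := q.start_mem_support
  have h1 : walkSum (cross a u) q = 0 := by
    rw [walkSum_congr q (g := fun _ _ => 0), walkSum_zero]
    intro x hx y hy hxy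
    exact cross_eq_zero hxy (fun e => hq (e ▸ hx)) (fun e => hq (e ▸ hy))
      (fun e => hpq u hu (e ▸ hx)) fun e => hpq u hu (e ▸ hy)
  have h2 : walkSum (fun x y => walkSum (cross x y) (.cons h' q)) p = 0 := by
    rw [walkSum_congr p (g := fun _ _ => 0), walkSum_zero]
    intro x hx y hy hxy
    have h3 : walkSum (cross x y) q = 0 := by
      rw [walkSum_congr q (g := fun _ _ => 0), walkSum_zero]
      intro x' hx' y' hy' hxy'
      exact cross_eq_zero hxy' (fun e => hpq x hx (e ▸ hx')) (fun e => hpq x hx (e ▸ hy'))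
        (fun e => hpq y hy (e ▸ hx')) fun e => hpq y hy (e ▸ hy')
    rw [walkSum, h3, add_zero]
    exact cross_eq_zero h' (fun e => hp (e ▸ hx)) (fun e => hpq x hx (e ▸ hu'))
      (fun e => hp (e ▸ hy)) fun e => hpq y hy (e ▸ hu')
  rw [crossings, walkSum, h2, walkSum, h1, add_zero, add_zero]

end crossings

/-- Among the ordered pairs of three distinct edges at a vertex, exactly one crosses: three of the
four directions contain either up and left, or right and down, but not both pairs. -/
lemma cross_three {a : ℤ × ℤ} {n : Fin 3 → ℤ × ℤ} (hn : ∀ i, grid.Adj a (n i))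
    (hinj : Function.Injective n) :
    cross a (n 1) a (n 0) + cross a (n 2) a (n 0) + (cross a (n 0) a (n 1) + cross a (n 2) a (n 1))
      + (cross a (n 0) a (n 2) + cross a (n 1) a (n 2)) = 1 := by
  have h01 := hinj.ne (show (0 : Fin 3) ≠ 1 by decide)
  have h02 := hinj.ne (show (0 : Fin 3) ≠ 2 by decide)
  have h12 := hinj.ne (show (1 : Fin 3) ≠ 2 by decide)
  let dir : Fin 4 → ℤ × ℤ := ![(1, 0), (0, 1), (-1, 0), (0, -1)]
  have hdir : ∀ x, grid.Adj a x → ∃ d, x = a + dir d := by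
    rintro ⟨x1, x2⟩ hx
    simp only [grid] at hx
    rcases hx with ⟨h, h' | h'⟩ | ⟨h, h' | h'⟩
    · exact ⟨1, Prod.ext (by simp [dir, h]) (by simp [dir, h'])⟩
    · exact ⟨3, Prod.ext (by simp [dir, h]) (by simp [dir, h'])⟩
    · exact ⟨0, Prod.ext (by simp [dir, h']) (by simp [dir, h])⟩
    · exact ⟨2, Prod.ext (by simp [dir, h']) (by simp [dir, h])⟩
  have hcross : ∀ d e, cross a (a + dir d) a (a + dir e) =
      if (d = 1 ∧ e = 2) ∨ (d = 0 ∧ e = 3) then 1 else 0 := by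
    intro d e
    unfold cross
    refine if_congr ?_ rfl rfl
    fin_cases d <;> fin_cases e <;> simp [dir] <;> omega
  obtain ⟨d, hd⟩ := hdir _ (hn 0)
  obtain ⟨e, he⟩ := hdir _ (hn 1)
  obtain ⟨f, hf⟩ := hdir _ (hn 2)
  rw [hd, he] at h01
  rw [hd, hf] at h02
  rw [he, hf] at h12
  have hde : d ≠ e := fun h => h01 (h ▸ rfl)
  have hdf : d ≠ f := fun h => h02 (h ▸ rfl)
  have hef : e ≠ f := fun h => h12 (h ▸ rfl)
  rw [hd, he, hf]
  simp only [hcross]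
  clear * - hde hdf hef
  revert d e f
  decide

/-- The graph `K_{3,3}` has no drawing in the grid. It is enough that walks are disjoint if they
belong to edges without a common end, and that the three walks from `a` meet only in `a`. -/
lemma grid_K33 {a b c : ℤ × ℤ} {m : Fin 3 → ℤ × ℤ} (α : ∀ i, grid.Walk a (m i))
    (β : ∀ i, grid.Walk b (m i)) (γ : ∀ i, grid.Walk c (m i)) (hm : ∀ i, m i ≠ a)
    (hα : ∀ i, (α i).IsPath)
    (hαα : ∀ i j, i ≠ j → ∀ x ∈ (α i).support, x ∈ (α j).support → x = a)
    (hαβ : ∀ i j, i ≠ j → ∀ x ∈ (α i).support, x ∉ (β j).support)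
    (hαγ : ∀ i j, i ≠ j → ∀ x ∈ (α i).support, x ∉ (γ j).support)
    (hβγ : ∀ i j, i ≠ j → ∀ x ∈ (β i).support, x ∉ (γ j).support) : False := by
  -- For `i ≠ j`, the walks `C i` and `P j` cross only at `a`. By `cross_three` the sum of these six
  -- numbers is odd. It is even, as the number of crossings of `C i` and `C j` together with `P k`
  -- does not depend on `k`.
  let C : Fin 3 → grid.Walk a b := fun i => (α i).append (β i).reverse
  let P : Fin 3 → grid.Walk a c := fun i => (α i).append (γ i).reverse
  have hfirst : ∀ i, ∃ (n : ℤ × ℤ) (h : grid.Adj a n) (p : grid.Walk n (m i)),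
      α i = .cons h p ∧ a ∉ p.support := by
    intro i
    have := hα i
    have hne := hm i
    cases hαi : α i with
    | nil => exact absurd rfl hne
    | cons h p =>
      rw [hαi, SimpleGraph.Walk.cons_isPath_iff] at this
      exact ⟨_, h, p, rfl, this.2⟩
  choose n hn p hp hap using hfirst
  have hpα : ∀ i, ∀ x ∈ (p i).support, x ∈ (α i).support := by
    intro i x hx
    rw [hp i, SimpleGraph.Walk.support_cons]
    exact List.mem_cons_of_mem _ hx
  have hpp : ∀ i j, i ≠ j → ∀ x ∈ (p i).support, x ∉ (p j).support := by
    intro i j hij x hx hx'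
    have := hαα i j hij x (hpα i x hx) (hpα j x hx')
    exact hap i (this ▸ hx)
  have hninj : Function.Injective n := by
    intro i j hij
    by_contra hne
    exact hpp i j hne (n i) (p i).start_mem_support (by rw [hij]; exact (p j).start_mem_support)
  have hE : ∀ i j, i ≠ j → crossings (C i) (P j) = cross a (n i) a (n j) := by
    intro i j hij
    have h1 : crossings (α i) (α j) = cross a (n i) a (n j) := by
      rw [hp i, hp j]
      exact crossings_cons_cons _ _ _ _ (hap i) (hap j) (hpp i j hij)
    rw [crossings_append_left, crossings_append_right, crossings_append_right,
      crossings_reverse_left, crossings_reverse_left, crossings_reverse_right,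
      crossings_reverse_right, h1, crossings_eq_zero (α i) (γ j) (hαγ i j hij),
      crossings_eq_zero (β i) (γ j) (hβγ i j hij),
      crossings_eq_zero (β i) (α j) fun x hx hx' => hαβ j i hij.symm x hx' hx]
    simp
  have hclosed : ∀ i j k, crossings (C i) (P k) + crossings (C j) (P k) =
      crossings (C i) (P 0) + crossings (C j) (P 0) := fun i j k => crossings_add_eq _ _ _ _
  have h3 := cross_three hn hninj
  rw [← hE 1 0 (by decide), ← hE 2 0 (by decide), ← hE 0 1 (by decide), ← hE 2 1 (by decide),
    ← hE 0 2 (by decide), ← hE 1 2 (by decide), hclosed 0 2 1, hclosed 0 1 2] at h3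
  generalize crossings (C 0) (P 0) = x at h3
  generalize crossings (C 1) (P 0) = y at h3
  generalize crossings (C 2) (P 0) = z at h3
  revert x y z
  decide

/-! ### Tripods in connected sets -/

section tripod

variable {V : Type*} {Γ : SimpleGraph V}

/-- A walk into `B`, cut off when it first reaches `B`. -/
lemma exists_first_hit (B : Set V) {u v : V} (p : Γ.Walk u v) (hv : v ∈ B) :
    ∃ w ∈ B, ∃ q : Γ.Walk u w, (∀ z ∈ q.support, z ∈ p.support) ∧
      ∀ z ∈ q.support, z ∈ B → z = w := by
  induction p with
  | nil => exact ⟨_, hv, .nil, fun _ h => h, by simp⟩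
  | @cons a b c h p ih =>
    by_cases ha : a ∈ B
    · exact ⟨a, ha, .nil, by simp, by simp⟩
    · obtain ⟨w, hw, q, hq1, hq2⟩ := ih hv
      refine ⟨w, hw, .cons h q, fun z hz => ?_, fun z hz hzB => ?_⟩
      · rw [SimpleGraph.Walk.support_cons, List.mem_cons] at hz ⊢
        exact hz.imp_right (hq1 z)
      · rw [SimpleGraph.Walk.support_cons, List.mem_cons] at hz
        rcases hz with rfl | hz
        · exact absurd hzB ha
        · exact hq2 z hz hzB

/-- Three vertices of a connected set are joined, inside the set, to a common vertex by walks that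
meet only there. -/
lemma exists_tripod {A : Set V} (hA : (Γ.induce A).Connected) {r : Fin 3 → V}
    (hr : ∀ i, r i ∈ A) :
    ∃ a ∈ A, ∃ L : ∀ i, Γ.Walk a (r i), (∀ i, ∀ x ∈ (L i).support, x ∈ A) ∧
      ∀ i j, i ≠ j → ∀ x ∈ (L i).support, x ∈ (L j).support → x = a := by
  classical
  have hA' := (connected_induce_iff.1 hA).2
  obtain ⟨P₀, hP₀⟩ := hA' _ (hr 0) _ (hr 1)
  let P := P₀.bypass
  have hP : P.IsPath := P₀.bypass_isPath
  have hPA : ∀ x ∈ P.support, x ∈ A := fun x hx => hP₀ x (P₀.support_bypass_subset_support hx)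
  obtain ⟨Q₀, hQ₀⟩ := hA' _ (hr 2) _ (hr 0)
  obtain ⟨a, ha, Q, hQ, hQP⟩ := exists_first_hit {x | x ∈ P.support} Q₀ P.start_mem_support
  have haP : a ∈ P.support := ha
  have htake : ∀ x ∈ (P.takeUntil a haP).support, x ∈ P.support := fun x hx =>
    P.support_takeUntil_subset_support haP hx
  have hdrop : ∀ x ∈ (P.dropUntil a haP).support, x ∈ P.support := fun x hx =>
    P.support_dropUntil_subset_support haP hx
  have h01 : ∀ x ∈ (P.takeUntil a haP).support, x ∈ (P.dropUntil a haP).support → x = a := by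
    intro x hx hx'
    have hnodup := hP.support_nodup
    rw [← P.take_spec haP, SimpleGraph.Walk.support_append, List.nodup_append] at hnodup
    rw [SimpleGraph.Walk.mem_support_iff] at hx'
    rcases hx' with h | h
    · exact h
    · exact absurd rfl (hnodup.2.2 x hx x h)
  let L : ∀ i, Γ.Walk a (r i) := fun i =>
    match i with
    | 0 => (P.takeUntil a haP).reverse
    | 1 => P.dropUntil a haP
    | 2 => Q.reverse
  have hL0 : ∀ x, x ∈ (L 0).support ↔ x ∈ (P.takeUntil a haP).support := fun x => by simp [L]
  have hL2 : ∀ x, x ∈ (L 2).support ↔ x ∈ Q.support := fun x => by simp [L]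
  have hlt : ∀ i j, i < j → ∀ x ∈ (L i).support, x ∈ (L j).support → x = a := by
    intro i j hij x hx hx'
    have hcases : (i = 0 ∧ j = 1) ∨ (i = 0 ∧ j = 2) ∨ (i = 1 ∧ j = 2) := by
      clear * - hij
      revert i j
      decide
    rcases hcases with ⟨rfl, rfl⟩ | ⟨rfl, rfl⟩ | ⟨rfl, rfl⟩
    · exact h01 x ((hL0 x).1 hx) hx'
    · exact hQP x ((hL2 x).1 hx') (htake x ((hL0 x).1 hx))
    · exact hQP x ((hL2 x).1 hx') (hdrop x hx)
  refine ⟨a, hPA a haP, L, fun i x hx => ?_, fun i j hij x hx hx' => ?_⟩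
  · fin_cases i
    · exact hPA x (htake x ((hL0 x).1 hx))
    · exact hPA x (hdrop x hx)
    · exact hQ₀ x (hQ x ((hL2 x).1 hx))
  · rcases lt_or_gt_of_ne hij with h | h
    · exact hlt i j h x hx hx'
    · exact hlt j i h x hx' hx

/-- A connected set `A` met by three disjoint connected sets contains a point with paths to given
points of these sets that have only their first point in common. -/
lemma exists_tripod_extension {A : Set V} {X : Fin 3 → Set V} {m : Fin 3 → V}
    (hA : (Γ.induce A).Connected) (hX : ∀ i, (Γ.induce (X i)).Connected)
    (hAX : ∀ i, (A ∩ X i).Nonempty) (hXX : ∀ i j, i ≠ j → Disjoint (X i) (X j))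
    (hm : ∀ i, m i ∈ X i) :
    ∃ a ∈ A, ∃ α : ∀ i, Γ.Walk a (m i), (∀ i, (α i).IsPath) ∧
      (∀ i, ∀ x ∈ (α i).support, x ∈ A ∪ X i) ∧
      ∀ i j, i ≠ j → ∀ x ∈ (α i).support, x ∈ (α j).support → x = a := by
  classical
  have hq : ∀ i, ∃ r ∈ A, ∃ q : Γ.Walk (m i) r, (∀ z ∈ q.support, z ∈ X i) ∧
      ∀ z ∈ q.support, z ∈ A → z = r := by
    intro i
    obtain ⟨y, hyA, hyX⟩ := hAX i
    obtain ⟨p, hp⟩ := (connected_induce_iff.1 (hX i)).2 _ (hm i) y hyX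
    obtain ⟨r, hr, q, hq1, hq2⟩ := exists_first_hit A p hyA
    exact ⟨r, hr, q, fun z hz => hp z (hq1 z hz), hq2⟩
  choose r hr q hqX hqA using hq
  obtain ⟨a, ha, L, hLA, hLL⟩ := exists_tripod hA hr
  have hsupp : ∀ i x, x ∈ ((L i).append (q i).reverse).bypass.support →
      x ∈ (L i).support ∨ x ∈ (q i).support := by
    intro i x hx
    have := SimpleGraph.Walk.support_bypass_subset_support _ hx
    rw [SimpleGraph.Walk.mem_support_append_iff, SimpleGraph.Walk.support_reverse,
      List.mem_reverse] at this
    exact this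
  have hqL : ∀ i j, i ≠ j → ∀ x ∈ (q i).support, x ∈ (L j).support → x = a := by
    intro i j hij x hx hx'
    have := hqA i x hx (hLA j x hx')
    subst this
    exact hLL i j hij _ (L i).end_mem_support hx'
  refine ⟨a, ha, fun i => ((L i).append (q i).reverse).bypass,
    fun i => SimpleGraph.Walk.bypass_isPath _, fun i x hx => ?_, fun i j hij x hx hx' => ?_⟩
  · rcases hsupp i x hx with h | h
    · exact .inl (hLA i x h)
    · exact .inr (hqX i x h)
  · rcases hsupp i x hx with h | h <;> rcases hsupp j x hx' with h' | h'
    · exact hLL i j hij x h h'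
    · exact hqL j i hij.symm x h' h
    · exact hqL i j hij x h h'
    · exact absurd (hqX j x h') (Set.disjoint_left.1 (hXX i j hij) (hqX i x h))

end tripod

/-- The version of `grid_K33` for connected sets in place of the vertices and edges. -/
lemma grid_K33_sets {A : Set (ℤ × ℤ)} {X Y Z : Fin 3 → Set (ℤ × ℤ)} {m : Fin 3 → ℤ × ℤ}
    {b c : ℤ × ℤ} (hA : (grid.induce A).Connected) (hX : ∀ i, (grid.induce (X i)).Connected)
    (hY : ∀ i, (grid.induce (Y i)).Connected) (hZ : ∀ i, (grid.induce (Z i)).Connected)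
    (hAX : ∀ i, (A ∩ X i).Nonempty) (hXX : ∀ i j, i ≠ j → Disjoint (X i) (X j))
    (hmX : ∀ i, m i ∈ X i) (hmA : ∀ i, m i ∉ A) (hmY : ∀ i, m i ∈ Y i) (hmZ : ∀ i, m i ∈ Z i)
    (hb : ∀ i, b ∈ Y i) (hc : ∀ i, c ∈ Z i) (hXY : ∀ i j, i ≠ j → Disjoint (A ∪ X i) (Y j))
    (hXZ : ∀ i j, i ≠ j → Disjoint (A ∪ X i) (Z j)) (hYZ : ∀ i j, i ≠ j → Disjoint (Y i) (Z j)) :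
    False := by
  obtain ⟨a, ha, α, hα, hαX, hαα⟩ := exists_tripod_extension hA hX hAX hXX hmX
  choose β hβ using fun i => (connected_induce_iff.1 (hY i)).2 b (hb i) (m i) (hmY i)
  choose γ hγ using fun i => (connected_induce_iff.1 (hZ i)).2 c (hc i) (m i) (hmZ i)
  exact grid_K33 α β γ (fun i h => hmA i (h ▸ ha)) hα hαα
    (fun i j hij x hx hx' => Set.disjoint_left.1 (hXY i j hij) (hαX i x hx) (hβ j x hx'))
    (fun i j hij x hx hx' => Set.disjoint_left.1 (hXZ i j hij) (hαX i x hx) (hγ j x hx'))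
    (fun i j hij x hx hx' => Set.disjoint_left.1 (hYZ i j hij) (hβ i x hx) (hγ j x hx'))

/-! ### Integer boxes -/

/-- The integer points of a box in the plane. -/
def intBox (l h : Fin 2 → ℤ) : Set (ℤ × ℤ) :=
  {p | (l 0 ≤ p.1 ∧ p.1 ≤ h 0) ∧ l 1 ≤ p.2 ∧ p.2 ≤ h 1}

lemma connected_intBox {l h : Fin 2 → ℤ} (hlh : ∀ i, l i ≤ h i) :
    (grid.induce (intBox l h)).Connected := by
  have hrow : ∀ (k : ℕ) (x y : ℤ), ∃ p : grid.Walk (x, y) (x + k, y),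
      ∀ z ∈ p.support, x ≤ z.1 ∧ z.1 ≤ x + k ∧ z.2 = y := by
    intro k
    induction k with
    | zero => exact fun x y => ⟨SimpleGraph.Walk.nil.copy rfl (by simp), by simp⟩
    | succ k ih =>
      intro x y
      obtain ⟨p, hp⟩ := ih x y
      have hadj : grid.Adj (x + k, y) (x + (k + 1 : ℕ), y) := by
        refine .inr ⟨rfl, .inl ?_⟩
        push_cast
        ring
      refine ⟨p.concat hadj, fun z hz => ?_⟩
      rw [SimpleGraph.Walk.support_concat, List.mem_append, List.mem_singleton] at hz
      rcases hz with hz | rfl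
      · have := hp z hz
        push_cast
        omega
      · push_cast
        refine ⟨?_, ?_, rfl⟩ <;> omega
  have hcol : ∀ (k : ℕ) (x y : ℤ), ∃ p : grid.Walk (x, y) (x, y + k),
      ∀ z ∈ p.support, z.1 = x ∧ y ≤ z.2 ∧ z.2 ≤ y + k := by
    intro k
    induction k with
    | zero => exact fun x y => ⟨SimpleGraph.Walk.nil.copy rfl (by simp), by simp⟩
    | succ k ih =>
      intro x y
      obtain ⟨p, hp⟩ := ih x y
      have hadj : grid.Adj (x, y + k) (x, y + (k + 1 : ℕ)) := by
        refine .inl ⟨rfl, .inl ?_⟩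
        push_cast
        ring
      refine ⟨p.concat hadj, fun z hz => ?_⟩
      rw [SimpleGraph.Walk.support_concat, List.mem_append, List.mem_singleton] at hz
      rcases hz with hz | rfl
      · have := hp z hz
        push_cast
        omega
      · push_cast
        refine ⟨rfl, ?_, ?_⟩ <;> omega
  have key : ∀ z ∈ intBox l h, ∃ p : grid.Walk (l 0, l 1) z, ∀ w ∈ p.support, w ∈ intBox l h := by
    rintro ⟨x, y⟩ ⟨⟨h1, h2⟩, h3, h4⟩
    simp only at h1 h2 h3 h4
    obtain ⟨i, rfl⟩ : ∃ i : ℕ, x = l 0 + i := ⟨(x - l 0).toNat, by omega⟩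
    obtain ⟨j, rfl⟩ : ∃ j : ℕ, y = l 1 + j := ⟨(y - l 1).toNat, by omega⟩
    obtain ⟨p, hp⟩ := hrow i (l 0) (l 1)
    obtain ⟨q, hq⟩ := hcol j (l 0 + i) (l 1)
    refine ⟨p.append q, fun w hw => ?_⟩
    rw [SimpleGraph.Walk.mem_support_append_iff] at hw
    rcases hw with hw | hw
    · obtain ⟨h5, h6, h7⟩ := hp w hw
      refine ⟨⟨?_, ?_⟩, ?_, ?_⟩ <;> omega
    · obtain ⟨h5, h6, h7⟩ := hq w hw
      refine ⟨⟨?_, ?_⟩, ?_, ?_⟩ <;> omega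
  refine connected_induce_iff.2 ⟨⟨(l 0, l 1), ⟨le_rfl, hlh 0⟩, le_rfl, hlh 1⟩, fun x hx y hy => ?_⟩
  obtain ⟨p, hp⟩ := key x hx
  obtain ⟨q, hq⟩ := key y hy
  refine ⟨p.reverse.append q, fun z hz => ?_⟩
  rw [SimpleGraph.Walk.mem_support_append_iff, SimpleGraph.Walk.support_reverse,
    List.mem_reverse] at hz
  exact hz.elim (hp z) (hq z)

/-- A box representation of a finite graph in dimension at most two can be replaced by one with
integer boxes in the plane, since only the order of the finitely many endpoints matters. -/
lemma exists_intBox_of_boxRepresentation {V : Type*} [Finite V] {G : SimpleGraph V} {d : ℕ}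
    (hd : d ≤ 2) (hG : ∃ B : V → Set (Fin d → ℝ), IsBoxRepresentation G B) :
    ∃ l h : V → Fin 2 → ℤ, (∀ v i, l v i ≤ h v i) ∧
      ∀ u v, u ≠ v → ((intBox (l u) (h u) ∩ intBox (l v) (h v)).Nonempty ↔ G.Adj u v) := by
  classical
  have := Fintype.ofFinite V
  obtain ⟨lo, hi, hle, hadj⟩ := (exists_isBoxRepresentation_iff G d).1 hG
  -- Missing coordinates are filled with zeros.
  let lo' : V → Fin 2 → ℝ := fun v i => if hi : (i : ℕ) < d then lo v ⟨i, hi⟩ else 0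
  let hi' : V → Fin 2 → ℝ := fun v i => if h : (i : ℕ) < d then hi v ⟨i, h⟩ else 0
  have hle' : ∀ v i, lo' v i ≤ hi' v i := by
    intro v i
    simp only [lo', hi']
    split_ifs
    · exact hle _ _
    · exact le_rfl
  have hadj' : ∀ u v, u ≠ v →
      ((∀ i, lo' u i ≤ hi' v i ∧ lo' v i ≤ hi' u i) ↔ G.Adj u v) := by
    intro u v huv
    rw [← hadj u v huv]
    constructor
    · intro h i
      have := h ⟨i, by omega⟩
      simpa [lo', hi'] using this
    · intro h i
      simp only [lo', hi']
      split_ifs with hi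
      · exact h ⟨i, hi⟩
      · exact ⟨le_rfl, le_rfl⟩
  let E : Finset ℝ := (Finset.univ.image fun q : V × Fin 2 => lo' q.1 q.2) ∪
    Finset.univ.image fun q : V × Fin 2 => hi' q.1 q.2
  have hlE : ∀ v i, lo' v i ∈ E := fun v i =>
    Finset.mem_union_left _ (Finset.mem_image.2 ⟨(v, i), Finset.mem_univ _, rfl⟩)
  have hhE : ∀ v i, hi' v i ∈ E := fun v i =>
    Finset.mem_union_right _ (Finset.mem_image.2 ⟨(v, i), Finset.mem_univ _, rfl⟩)
  -- The rank among the endpoints; it preserves their order.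
  let r : ℝ → ℤ := fun x => ((E.filter (· < x)).card : ℤ)
  have hr : ∀ x y, y ∈ E → (r x ≤ r y ↔ x ≤ y) := by
    intro x y hy
    simp only [r, Nat.cast_le]
    constructor
    · intro h
      by_contra! hlt
      refine absurd (Finset.card_lt_card ?_) (not_lt.2 h)
      refine Finset.ssubset_iff_of_subset (fun z hz => ?_) |>.2 ⟨y, ?_, ?_⟩
      · rw [Finset.mem_filter] at hz ⊢
        exact ⟨hz.1, hz.2.trans hlt⟩
      · exact Finset.mem_filter.2 ⟨hy, hlt⟩
      · simp
    · intro h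
      refine Finset.card_le_card fun z hz => ?_
      rw [Finset.mem_filter] at hz ⊢
      exact ⟨hz.1, hz.2.trans_le h⟩
  refine ⟨fun v i => r (lo' v i), fun v i => r (hi' v i),
    fun v i => (hr _ _ (hhE v i)).2 (hle' v i), fun u v huv => ?_⟩
  rw [← hadj' u v huv]
  constructor
  · rintro ⟨z, ⟨⟨h1, h2⟩, h3, h4⟩, ⟨h5, h6⟩, h7, h8⟩ i
    rw [← hr _ _ (hhE v i), ← hr _ _ (hhE u i)]
    fin_cases i
    · exact ⟨h1.trans h6, h5.trans h2⟩
    · exact ⟨h3.trans h8, h7.trans h4⟩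
  · intro h
    have h' : ∀ i, r (lo' u i) ≤ r (hi' v i) ∧ r (lo' v i) ≤ r (hi' u i) := fun i =>
      ⟨(hr _ _ (hhE v i)).2 (h i).1, (hr _ _ (hhE u i)).2 (h i).2⟩
    have hu : ∀ i, r (lo' u i) ≤ r (hi' u i) := fun i => (hr _ _ (hhE u i)).2 (hle' u i)
    have hv : ∀ i, r (lo' v i) ≤ r (hi' v i) := fun i => (hr _ _ (hhE v i)).2 (hle' v i)
    refine ⟨(max (r (lo' u 0)) (r (lo' v 0)), max (r (lo' u 1)) (r (lo' v 1))),
      ⟨⟨?_, ?_⟩, ?_, ?_⟩, ⟨?_, ?_⟩, ?_, ?_⟩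
    · exact le_max_left _ _
    · exact max_le (hu 0) (h' 0).2
    · exact le_max_left _ _
    · exact max_le (hu 1) (h' 1).2
    · exact le_max_right _ _
    · exact max_le (h' 0).1 (hv 0)
    · exact le_max_right _ _
    · exact max_le (h' 1).1 (hv 1)

/-! ### Subdivisions of `K_{3,3}` -/

/-- The vertices of the graph obtained from `K_{3,3}` by replacing every edge with a path through
`n` new vertices: the two sides `hub` and `spoke`, and the vertices `inner i j k` of the path
from `hub i` to `spoke j`. -/
inductive SubK33 (n : ℕ) : Type u
  | hub (i : Fin 3) : SubK33 n
  | spoke (j : Fin 3) : SubK33 n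
  | inner (i j : Fin 3) (k : Fin n) : SubK33 n

namespace SubK33

variable {n : ℕ}

instance : Finite (SubK33.{u} n) := by
  refine Finite.of_injective (β := Fin 3 ⊕ Fin 3 ⊕ (Fin 3 × Fin 3 × Fin n))
    (fun v => match v with
      | hub i => .inl i
      | spoke j => .inr (.inl j)
      | inner i j k => .inr (.inr (i, j, k))) ?_
  intro a b h
  cases a <;> cases b <;> simp_all

/-- One step on the path from a hub to a spoke. -/
def Next : SubK33.{u} n → SubK33.{u} n → Prop
  | hub i, inner i' _ k => i = i' ∧ (k : ℕ) = 0
  | inner i j k, inner i' j' k' => i = i' ∧ j = j' ∧ (k : ℕ) + 1 = k'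
  | inner _ j k, spoke j' => j = j' ∧ (k : ℕ) + 1 = n
  | _, _ => False

/-- The subdivision of `K_{3,3}`. -/
def graph (n : ℕ) : SimpleGraph (SubK33.{u} n) where
  Adj a b := Next a b ∨ Next b a
  symm := ⟨fun _ _ h => h.symm⟩
  loopless := ⟨fun a h => by cases a <;> simp [Next] at h⟩

/-- The vertex before `inner i j k` on its path. -/
def pred (i j : Fin 3) (k : Fin n) : SubK33.{u} n :=
  if h : (k : ℕ) = 0 then hub i else inner i j ⟨k - 1, by omega⟩

/-- The vertex after `inner i j k` on its path. -/
def succ (i j : Fin 3) (k : Fin n) : SubK33.{u} n :=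
  if h : (k : ℕ) + 1 = n then spoke j else inner i j ⟨k + 1, by omega⟩

lemma eq_pred_or_succ {i j : Fin 3} {k : Fin n} {x : SubK33.{u} n}
    (h : (graph n).Adj (inner i j k) x) : x = pred i j k ∨ x = succ i j k := by
  unfold pred succ
  rcases h with h | h
  · right
    cases x with
    | hub i' => simp [Next] at h
    | spoke j' =>
      obtain ⟨rfl, h⟩ := h
      rw [dif_pos h]
    | inner i' j' k' =>
      obtain ⟨rfl, rfl, h⟩ := h
      rw [dif_neg (by omega)]
      congr 1
      exact Fin.ext h.symm
  · left
    cases x with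
    | hub i' =>
      obtain ⟨rfl, h⟩ := h
      rw [dif_pos h]
    | spoke j' => simp [Next] at h
    | inner i' j' k' =>
      obtain ⟨rfl, rfl, h⟩ := h
      rw [dif_neg (by omega)]
      congr 1
      exact Fin.ext (by simp only; omega)

/-- A cycle contains an inner vertex, and together with it the whole path of that vertex. -/
lemma le_egirth (n : ℕ) : (n : ℕ∞) ≤ (graph.{u} (n + 1)).egirth := by
  classical
  rw [SimpleGraph.le_egirth]
  intro a w hw
  have hnb : ∀ v ∈ w.support, (w.toSubgraph.neighborSet v).ncard = 2 := fun v hv =>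
    hw.ncard_neighborSet_toSubgraph_eq_two hv
  have hsupp : ∀ v x, x ∈ w.toSubgraph.neighborSet v → x ∈ w.support := by
    intro v x hx
    rw [← SimpleGraph.Walk.mem_verts_toSubgraph]
    exact w.toSubgraph.edge_vert (SimpleGraph.Subgraph.Adj.symm hx)
  obtain ⟨i, j, k, hk⟩ : ∃ i j k, inner i j k ∈ w.support := by
    have hne : (w.toSubgraph.neighborSet a).Nonempty :=
      Set.nonempty_of_ncard_ne_zero (by rw [hnb a w.start_mem_support]; norm_num)
    obtain ⟨x, hx⟩ := hne
    have hadj : (graph (n + 1)).Adj a x := SimpleGraph.Subgraph.Adj.adj_sub hx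
    have hxs := hsupp a x hx
    cases a with
    | inner i j k => exact ⟨i, j, k, w.start_mem_support⟩
    | hub i =>
      cases x with
      | inner i j k => exact ⟨i, j, k, hxs⟩
      | hub _ => simp [graph, Next] at hadj
      | spoke _ => simp [graph, Next] at hadj
    | spoke i =>
      cases x with
      | inner i j k => exact ⟨i, j, k, hxs⟩
      | hub _ => simp [graph, Next] at hadj
      | spoke _ => simp [graph, Next] at hadj
  have hboth : ∀ k, inner i j k ∈ w.support →
      pred i j k ∈ w.support ∧ succ i j k ∈ w.support := by
    intro k hk
    have hsub : w.toSubgraph.neighborSet (inner i j k) ⊆ {pred i j k, succ i j k} := by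
      intro x hx
      exact eq_pred_or_succ (SimpleGraph.Subgraph.Adj.adj_sub hx)
    have heq := Set.eq_of_subset_of_ncard_le hsub
      (by rw [hnb _ hk]; exact (Set.ncard_insert_le _ _).trans (by simp))
    exact ⟨hsupp _ _ (by rw [heq]; simp), hsupp _ _ (by rw [heq]; simp)⟩
  have hup : ∀ (m : ℕ) (hm : (k : ℕ) + m < n + 1), inner i j ⟨k + m, hm⟩ ∈ w.support := by
    intro m
    induction m with
    | zero => exact fun _ => hk
    | succ m ih =>
      intro hm
      have := (hboth _ (ih (by omega))).2
      rw [succ, dif_neg (by simp only; omega)] at this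
      exact this
  have hdown : ∀ (m : ℕ) (hm : (k : ℕ) - m < n + 1), inner i j ⟨k - m, hm⟩ ∈ w.support := by
    intro m
    induction m with
    | zero => exact fun _ => hk
    | succ m ih =>
      intro hm
      rcases Nat.lt_or_ge m k with h | h
      · have := (hboth _ (ih (by omega))).1
        rw [pred, dif_neg (by simp only; omega)] at this
        convert this using 2
        exact Fin.ext (by simp only; omega)
      · have := ih (by omega)
        convert this using 3
        omega
  have hall : ∀ l : Fin (n + 1), inner i j l ∈ w.support := by
    intro l
    rcases Nat.le_total k l with h | h
    · have := hup (l - k) (by omega)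
      convert this using 2
      exact Fin.ext (by simp only; omega)
    · have := hdown (k - l) (by omega)
      convert this using 2
      exact Fin.ext (by simp only; omega)
  have hcard : (Finset.univ.image fun l : Fin (n + 1) => inner.{u} i j l).card ≤
      w.support.toFinset.card := by
    refine Finset.card_le_card fun x hx => ?_
    obtain ⟨l, -, rfl⟩ := Finset.mem_image.1 hx
    exact List.mem_toFinset.2 (hall l)
  rw [Finset.card_image_of_injective _ (fun a b h => by simpa using h), Finset.card_univ,
    Fintype.card_fin] at hcard
  have := hcard.trans (List.toFinset_card_le _)
  rw [SimpleGraph.Walk.length_support] at this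
  exact_mod_cast (by omega : n ≤ w.length)

end SubK33

/-! ### Complete minors and branch vertices -/

open Classical in
/-- A connected set `B` with five edges leaving it has total degree at least `2 * |B| + 3`: the
edges inside `B` contribute at least `2 * (|B| - 1)`. -/
lemma two_mul_card_add_le {V : Type*} [Fintype V] {G : SimpleGraph V} {B : Finset V}
    (hB : (G.induce (B : Set V)).Connected) (x y : Fin 5 → V) (hx : ∀ i, x i ∈ B)
    (hy : ∀ i, y i ∉ B) (hyinj : Function.Injective y) (hxy : ∀ i, G.Adj (x i) (y i)) :
    2 * B.card + 3 ≤ ∑ v ∈ B, (Finset.univ.filter fun w => G.Adj v w).card := by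
  have hsum : ∑ v ∈ B, (Finset.univ.filter fun w => G.Adj v w).card =
      ((B ×ˢ Finset.univ).filter fun q : V × V => G.Adj q.1 q.2).card := by
    rw [Finset.card_filter, Finset.sum_product]
    simp only [Finset.card_filter]
  have hin : 2 * B.card ≤ dartCount G B + 2 := by
    have h1 := hB.card_vert_le_card_edgeSet_add_one
    rw [Nat.card_eq_fintype_card, Nat.card_eq_fintype_card, ← SimpleGraph.edgeFinset_card] at h1
    have h2 := (G.induce (B : Set V)).dart_card_eq_twice_card_edges
    have h3 : Fintype.card (G.induce (B : Set V)).Dart ≤ dartCount G B := by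
      unfold dartCount
      rw [← Finset.card_univ]
      refine Finset.card_le_card_of_injOn
        (fun d => ((d.fst : V), (d.snd : V))) (fun d _ => ?_) fun d _ d' _ h => ?_
      · simp only [Finset.coe_filter, Finset.mem_product, Set.mem_ofPred_eq]
        exact ⟨⟨d.fst.2, d.snd.2⟩, d.adj⟩
      · simp only [Prod.mk.injEq] at h
        exact SimpleGraph.Dart.ext _ _ (Prod.ext (Subtype.ext h.1) (Subtype.ext h.2))
    have h4 : Fintype.card (B : Set V) = B.card := by simp
    omega
  have hout : 5 ≤ ((B ×ˢ Bᶜ).filter fun q : V × V => G.Adj q.1 q.2).card := by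
    calc 5 = (Finset.univ.image fun i => (x i, y i)).card := by
          rw [Finset.card_image_of_injective _ fun i j h => hyinj (Prod.ext_iff.1 h).2]
          simp
      _ ≤ _ := by
          refine Finset.card_le_card fun q hq => ?_
          obtain ⟨i, -, rfl⟩ := Finset.mem_image.1 hq
          simp [hx i, hy i, hxy i]
  have hsplit : dartCount G B + ((B ×ˢ Bᶜ).filter fun q : V × V => G.Adj q.1 q.2).card ≤
      ((B ×ˢ Finset.univ).filter fun q : V × V => G.Adj q.1 q.2).card := by
    unfold dartCount
    rw [← Finset.card_union_of_disjoint]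
    · refine Finset.card_le_card fun q hq => ?_
      simp only [Finset.mem_union, Finset.mem_filter, Finset.mem_product, Finset.mem_univ,
        and_true] at hq ⊢
      tauto
    · rw [Finset.disjoint_left]
      intro q hq hq'
      simp only [Finset.mem_filter, Finset.mem_product, Finset.mem_compl] at hq hq'
      exact hq'.1.2 hq.1.2
  omega

open Classical in
/-- A graph of maximum degree three with at most `17` vertices of degree three has no minor
`K_6`: each branch set has to contain at least three of them. -/
lemma not_isMinor_K6 {V : Type*} [Fintype V] {G : SimpleGraph V} (D : Finset V)
    (hD : D.card < 18) (h2 : ∀ v ∉ D, (Finset.univ.filter fun w => G.Adj v w).card ≤ 2)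
    (h3 : ∀ v ∈ D, (Finset.univ.filter fun w => G.Adj v w).card ≤ 3) :
    ¬ IsMinor (⊤ : SimpleGraph (Fin 6)) G := by
  rintro ⟨B, hBc, hBd, hBa⟩
  have hthree : ∀ w, 3 ≤ (D.filter fun v => v ∈ B w).card := by
    intro w
    have hother : ∀ i : Fin 5, ∃ x ∈ B w, ∃ y ∈ B (w.succAbove i), G.Adj x y := fun i =>
      hBa w (w.succAbove i) (Fin.succAbove_ne w i).symm
    choose x hx y hy hxy using hother
    let C : Finset V := Finset.univ.filter fun v => v ∈ B w
    have hC : (C : Set V) = B w := by ext v; simp [C]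
    have h := two_mul_card_add_le (G := G) (B := C) (hC ▸ hBc w) x y (fun i => by simp [C, hx i])
      (fun i hi => Set.disjoint_left.1 (hBd _ _ (Fin.succAbove_ne w i)) (hy i)
        (by simpa [C] using hi))
      (fun i j hij => by
        by_contra hne
        refine Set.disjoint_left.1 (hBd _ _ (fun h => hne (Fin.succAbove_right_injective h)))
          (hy i) ?_
        rw [hij]
        exact hy j) hxy
    have h' : ∑ v ∈ C, (Finset.univ.filter fun w => G.Adj v w).card ≤
        ∑ v ∈ C, (2 + if v ∈ D then 1 else 0) := by
      refine Finset.sum_le_sum fun v _ => ?_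
      split_ifs with hv
      · exact h3 v hv
      · exact h2 v hv
    rw [Finset.sum_add_distrib, ← Finset.card_filter, Finset.sum_const, smul_eq_mul] at h'
    have h5 : (C.filter fun v => v ∈ D) = D.filter fun v => v ∈ B w := by
      ext v
      simp [C, and_comm]
    rw [h5] at h'
    omega
  have hsum : ∑ w : Fin 6, (D.filter fun v => v ∈ B w).card ≤ D.card := by
    rw [← Finset.card_biUnion]
    · exact Finset.card_le_card (Finset.biUnion_subset.2 fun _ _ => Finset.filter_subset _ _)
    · intro i _ j _ hij
      rw [Function.onFun, Finset.disjoint_left]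
      intro v hv hv'
      exact Set.disjoint_left.1 (hBd i j hij) (Finset.mem_filter.1 hv).2 (Finset.mem_filter.1 hv').2
  have := (Finset.sum_le_sum fun w (_ : w ∈ Finset.univ) => hthree w).trans hsum
  simp at this
  omega

namespace SubK33

variable {n : ℕ}

lemma not_isMinor_K6 (n : ℕ) :
    ¬ IsMinor (⊤ : SimpleGraph (Fin 6)) (graph.{u} (n + 1)) := by
  classical
  have := Fintype.ofFinite (SubK33.{u} (n + 1))
  refine BoxGraph.not_isMinor_K6
    (Finset.univ.image hub ∪ Finset.univ.image spoke) ?_ (fun v hv => ?_) fun v hv => ?_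
  · have h1 := Finset.card_union_le (Finset.univ.image (hub.{u} (n := n + 1)))
      (Finset.univ.image spoke)
    have h2 := Finset.card_image_le (s := Finset.univ) (f := hub.{u} (n := n + 1))
    have h3 := Finset.card_image_le (s := Finset.univ) (f := spoke.{u} (n := n + 1))
    rw [Finset.card_univ, Fintype.card_fin] at h2 h3
    omega
  · cases v with
    | hub i => simp at hv
    | spoke j => simp at hv
    | inner i j k =>
      refine le_trans (Finset.card_le_card (t := {pred i j k, succ i j k}) fun x hx => ?_)
        Finset.card_le_two
      have := eq_pred_or_succ (Finset.mem_filter.1 hx).2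
      simpa using this
  · rcases Finset.mem_union.1 hv with hv | hv
    · obtain ⟨i, -, rfl⟩ := Finset.mem_image.1 hv
      refine le_trans (Finset.card_le_card
        (t := Finset.univ.image fun j => inner i j 0) fun x hx => ?_)
        (Finset.card_image_le.trans (by simp))
      have hadj := (Finset.mem_filter.1 hx).2
      cases x with
      | hub _ => simp [graph, Next] at hadj
      | spoke _ => simp [graph, Next] at hadj
      | inner i' j k =>
        rcases hadj with ⟨rfl, hk⟩ | h
        · exact Finset.mem_image.2 ⟨j, Finset.mem_univ _, by rw [Fin.ext (a := k) (b := 0) hk]⟩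
        · simp [Next] at h
    · obtain ⟨j, -, rfl⟩ := Finset.mem_image.1 hv
      refine le_trans (Finset.card_le_card
        (t := Finset.univ.image fun i => inner i j (Fin.last n)) fun x hx => ?_)
        (Finset.card_image_le.trans (by simp))
      have hadj := (Finset.mem_filter.1 hx).2
      cases x with
      | hub _ => simp [graph, Next] at hadj
      | spoke _ => simp [graph, Next] at hadj
      | inner i j' k =>
        rcases hadj with h | ⟨rfl, hk⟩
        · simp [Next] at h
        · refine Finset.mem_image.2 ⟨i, Finset.mem_univ _, ?_⟩
          rw [Fin.ext (a := k) (b := Fin.last n) (by simpa using hk)]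

/-! ### Subdivisions of `K_{3,3}` have no planar box representation -/

/-- The path from `hub i` to `spoke j`, without its first vertex. -/
def openArm (i j : Fin 3) : Set (SubK33.{u} n) :=
  {v | v = spoke j ∨ ∃ k, v = inner i j k}

/-- The path from `hub i` to `spoke j`. -/
def arm (i j : Fin 3) : Set (SubK33.{u} n) :=
  Insert.insert (hub i) (openArm i j)

lemma connected_openArm (i j : Fin 3) :
    ((graph.{u} (n + 1)).induce (openArm i j)).Connected := by
  have key : ∀ (m : ℕ) (k : Fin (n + 1)), n - k = m →
      ∃ p : (graph (n + 1)).Walk (inner i j k) (spoke j), ∀ z ∈ p.support, z ∈ openArm i j := by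
    intro m
    induction m with
    | zero =>
      intro k hk
      have h : (graph (n + 1)).Adj (inner i j k) (spoke j) := .inl ⟨rfl, by omega⟩
      refine ⟨.cons h .nil, fun z hz => ?_⟩
      simp only [SimpleGraph.Walk.support_cons, SimpleGraph.Walk.support_nil, List.mem_cons,
        List.not_mem_nil, or_false] at hz
      rcases hz with rfl | rfl
      · exact .inr ⟨k, rfl⟩
      · exact .inl rfl
    | succ m ih =>
      intro k hk
      obtain ⟨p, hp⟩ := ih ⟨k + 1, by omega⟩ (by simp only; omega)
      have h : (graph (n + 1)).Adj (inner i j k) (inner i j ⟨k + 1, by omega⟩) :=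
        .inl ⟨rfl, rfl, rfl⟩
      refine ⟨.cons h p, fun z hz => ?_⟩
      rw [SimpleGraph.Walk.support_cons, List.mem_cons] at hz
      rcases hz with rfl | hz
      · exact .inr ⟨k, rfl⟩
      · exact hp z hz
  have key' : ∀ v ∈ openArm i j, ∃ p : (graph (n + 1)).Walk v (spoke j),
      ∀ z ∈ p.support, z ∈ openArm i j := by
    rintro v (rfl | ⟨k, rfl⟩)
    · exact ⟨.nil, by simp [openArm]⟩
    · exact key _ k rfl
  refine connected_induce_iff.2 ⟨⟨_, .inl rfl⟩, fun x hx y hy => ?_⟩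
  obtain ⟨p, hp⟩ := key' x hx
  obtain ⟨q, hq⟩ := key' y hy
  refine ⟨p.append q.reverse, fun z hz => ?_⟩
  rw [SimpleGraph.Walk.mem_support_append_iff, SimpleGraph.Walk.support_reverse,
    List.mem_reverse] at hz
  exact hz.elim (hp z) (hq z)

lemma connected_arm (i j : Fin 3) : ((graph.{u} (n + 1)).induce (arm i j)).Connected := by
  have h : (graph.{u} (n + 1)).Adj (hub i) (inner i j 0) := .inl ⟨rfl, rfl⟩
  have := SimpleGraph.induce_union_connected
    (SimpleGraph.induce_pair_connected_of_adj h).preconnected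
    (connected_openArm (n := n) i j).preconnected ⟨inner i j 0, Or.inr rfl, Or.inr ⟨0, rfl⟩⟩
  have e : arm.{u} (n := n + 1) i j = {hub i, inner i j 0} ∪ openArm i j := by
    ext v
    simp only [arm, openArm, Set.mem_insert_iff, Set.mem_union, Set.mem_singleton_iff,
      Set.mem_ofPred_eq]
    constructor
    · tauto
    · rintro ((h | h) | h)
      · exact .inl h
      · exact .inr (.inr ⟨0, h⟩)
      · exact .inr h
  rw [e]
  exact this

lemma arm_disjoint {i i' j j' : Fin 3} (hi : i ≠ i') (hj : j ≠ j') :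
    ∀ u ∈ arm.{u} (n := n) i j, ∀ v ∈ arm i' j', u ≠ v ∧ ¬ (graph n).Adj u v := by
  rintro u (rfl | rfl | ⟨k, rfl⟩) v (rfl | rfl | ⟨k', rfl⟩) <;>
    simp [graph, Next, hi, hj, hi.symm, hj.symm]

lemma openArm_disjoint {i j j' : Fin 3} (hj : j ≠ j') :
    ∀ u ∈ openArm.{u} (n := n) i j, ∀ v ∈ openArm i j', u ≠ v ∧ ¬ (graph n).Adj u v := by
  rintro u (rfl | ⟨k, rfl⟩) v (rfl | ⟨k', rfl⟩) <;> simp [graph, Next, hj, hj.symm]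

/-- A representation would give a planar drawing of `K_{3,3}`, with the edges drawn inside the
unions of the boxes of the paths. -/
lemma three_le_boxicity (n : ℕ) : 3 ≤ boxicity (graph.{u} (n + 1)) := by
  refine le_iInf₂ fun d hd => ?_
  by_contra! hlt
  have hd2 : d ≤ 2 := by
    have : d < 3 := by exact_mod_cast hlt
    omega
  obtain ⟨l, h, hle, hadj⟩ := exists_intBox_of_boxRepresentation hd2 hd.2
  let S : SubK33.{u} (n + 1) → Set (ℤ × ℤ) := fun v => intBox (l v) (h v)
  let U : Set (SubK33.{u} (n + 1)) → Set (ℤ × ℤ) := fun T => ⋃ v ∈ T, S v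
  have hS : ∀ v, (grid.induce (S v)).Connected := fun v => connected_intBox (hle v)
  have hU : ∀ T, ((graph (n + 1)).induce T).Connected → (grid.induce (U T)).Connected := by
    intro T hT
    refine connected_biUnion hT (fun v _ => hS v) fun v _ w _ hvw => ?_
    obtain ⟨z, hz, hz'⟩ := (hadj v w hvw.ne).2 hvw
    exact ⟨z, hz, z, hz', .inl rfl⟩
  have hdisj : ∀ T T', (∀ u ∈ T, ∀ v ∈ T', u ≠ v ∧ ¬ (graph (n + 1)).Adj u v) →
      Disjoint (U T) (U T') := by
    intro T T' hT
    rw [Set.disjoint_left]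
    intro z hz hz'
    simp only [U, Set.mem_iUnion] at hz hz'
    obtain ⟨u, hu, hz⟩ := hz
    obtain ⟨v, hv, hz'⟩ := hz'
    obtain ⟨hne, hnadj⟩ := hT u hu v hv
    exact hnadj ((hadj u v hne).1 ⟨z, hz, hz'⟩)
  have hmem : ∀ T v, v ∈ T → S v ⊆ U T := fun T v hv => Set.subset_biUnion_of_mem hv
  have hpt : ∀ v, ∃ z, z ∈ S v := fun v => (connected_induce_iff.1 (hS v)).1
  choose z hz using hpt
  have hspoke : ∀ i j, spoke j ∈ arm.{u} (n := n + 1) i j := fun i j => .inr (.inl rfl)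
  have hhub : ∀ i j, hub i ∈ arm.{u} (n := n + 1) i j := fun i j => .inl rfl
  have hAX : ∀ j, S (hub 0) ∪ U (openArm 0 j) ⊆ U (arm 0 j) := by
    intro j
    refine Set.union_subset (hmem _ _ (hhub 0 j)) ?_
    exact Set.biUnion_subset_biUnion_left fun v hv => .inr hv
  refine grid_K33_sets (A := S (hub 0)) (X := fun j => U (openArm 0 j))
    (Y := fun j => U (arm 1 j)) (Z := fun j => U (arm 2 j)) (m := fun j => z (spoke j))
    (b := z (hub 1)) (c := z (hub 2)) (hS _) (fun j => hU _ (connected_openArm 0 j))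
    (fun j => hU _ (connected_arm 1 j)) (fun j => hU _ (connected_arm 2 j)) (fun j => ?_)
    (fun i j hij => hdisj _ _ (openArm_disjoint hij))
    (fun j => hmem _ _ (.inl rfl) (hz _)) (fun j hj => ?_)
    (fun j => hmem _ _ (hspoke 1 j) (hz _)) (fun j => hmem _ _ (hspoke 2 j) (hz _))
    (fun j => hmem _ _ (hhub 1 j) (hz _)) (fun j => hmem _ _ (hhub 2 j) (hz _))
    (fun i j hij => (hdisj _ _ (arm_disjoint (by decide) hij)).mono_left (hAX i))
    (fun i j hij => (hdisj _ _ (arm_disjoint (by decide) hij)).mono_left (hAX i))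
    (fun i j hij => hdisj _ _ (arm_disjoint (by decide) hij))
  · have h : (graph.{u} (n + 1)).Adj (hub 0) (inner 0 j 0) := .inl ⟨rfl, rfl⟩
    obtain ⟨x, hx, hx'⟩ := (hadj _ _ h.ne).2 h
    exact ⟨x, hx, hmem _ _ (.inr ⟨0, rfl⟩) hx'⟩
  · have := (hadj (hub 0) (spoke j) (by simp)).1 ⟨z (spoke j), hj, hz _⟩
    simp [graph, Next] at this

end SubK33

end BoxGraph

theorem corollary5p2 :
    (∀ F : BoxGraph.GraphClass.{u}, F.IsMinorClosed → F.IsProper →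
      ∃ g : ℕ, ∀ (V : Type u) [Finite V] (G : SimpleGraph V),
        F V G → (g : ℕ∞) ≤ G.egirth → BoxGraph.boxicity G ≤ 3) ∧
    (∀ g : ℕ, ∃ (V : Type u) (_ : Finite V) (G : SimpleGraph V),
      ¬ BoxGraph.IsMinor (⊤ : SimpleGraph (Fin 6)) G ∧
        (g : ℕ∞) ≤ G.egirth ∧ BoxGraph.boxicity G = 3) := by
  refine ⟨fun F hF hp => BoxGraph.exists_girth_of_minorClosed hF hp, fun g => ?_⟩
  obtain ⟨g₀, hg₀⟩ := BoxGraph.exists_boxicity_le_three 6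
  have hgirth := BoxGraph.SubK33.le_egirth.{u} (max g g₀)
  have hK6 := BoxGraph.SubK33.not_isMinor_K6.{u} (max g g₀)
  refine ⟨BoxGraph.SubK33.{u} (max g g₀ + 1), inferInstance, BoxGraph.SubK33.graph _, hK6,
    le_trans (by exact_mod_cast le_max_left g g₀) hgirth,
    le_antisymm (hg₀ _ (le_trans (by exact_mod_cast le_max_right g g₀) hgirth) hK6)
      (BoxGraph.SubK33.three_le_boxicity _)⟩
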